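/- Let $-\infty<a<b<\infty$, $d\in\mathbb{N}$, $\varrho\in(0,1]$, $K,L\in(0,\infty)$ and $p\in[2,\infty)$, and let $\|\cdot\|$ be the one norm on $\mathbb{R}^d$. Let $F=F^\varrho_\infty(a,b,d,\varrho,K,L)$ be the class of pairs $(\eta,f)$, $\eta\in\mathbb{R}^d$, $f\colon[a,b]\times\mathbb{R}^d\to\mathbb{R}^d$, such that $\|\eta\|\le K$, $f$ is continuous, and for all $t,s\in[a,b]$, $x,y\in\mathbb{R}^d$ $$\|f(t,x)\|\le K(1+\|x\|),\quad \|f(t,x)-f(s,x)\|\le L|t-s|^\varrho,\quad \|f(t,x)-f(t,y)\|\le L\|x-y\|.$$ For $\delta\in[0,1]$ let $\mathcal K_2(\delta)$ be the class of Borel measurable $g\colon[a,b]\times\mathbb{R}^d\to\mathbb{R}^d$ with $\|g(t,y)\|\le\delta(1+\|y\|)$ and $\|g(t,x)-g(t,y)\|\le\delta\|x-y\|$ for all $t\in[a,b]$, $x,y\in\mathbb{R}^d$, and let $V^2_{(\eta,f)}(\delta)$ be the set of all pairs $(\tilde\eta,\tilde f)$ with $\|\tilde\eta-\eta\|\le\delta$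 and $\tilde f=f+g$ for some $g\in\mathcal K_2(\delta)$. Let $n\ge1$ be an integer, $h=(b-a)/n$, $t_j=a+jh$, let $\tau_1,\dots,\tau_n$ be independent random variables with uniform distribution on $(0,1)$ on a complete probability space $(\Omega,\Sigma,\mathbb P)$, and $\theta_j=t_{j-1}+\tau_jh$. A solution of the randomized implicit Euler scheme is a sequence of maps $\bar U^0,\dots,\bar U^n\colon\Omega\to\mathbb{R}^d$ with, almost surely, $$\bar U^0=\tilde\eta,\qquad \bar U^j=\bar U^{j-1}+h\,\tilde f(\theta_j,\bar U^j),\quad j=1,\dots,n,$$ and $\bar l^{IE}\colon[a,b]\to\mathbb{R}^d$ is the continuous piecewise linear function with nodes $t_0,\dots,t_n$ and values $\bar l^{IE}(t_j)=\bar U^j$. Let $\mathcal F_j$ be the $\sigma$-algebra generated by $\tau_1,\dots,\tau_j$ and the sets $A\in\Sigma$ with $\mathbb P(A)=0$. Then there is a constant $C>0$, depending only on $a,b,d,K,L,\varrho,p$, such that for all such probability spaces and $\tau_j$, all $\delta\in[0,1]$, $(\eta,f)\in F$, $(\tilde\eta,\tilde f)\in V^2_{(\eta,f)}(\delta)$ and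 $n\ge1$ with $h(K+1)\le\frac12$ and $hL\le\frac12$ the following holds. 1. The initial-value problem $z'(t)=f(t,z(t))$, $t\in[a,b]$, $z(a)=\eta$, has a unique solution $z$ on $[a,b]$. 2. The scheme has a solution $(\bar U^j)_{j=0}^n$ such that $\bar U^j$ is $\mathcal F_j$-measurable for every $j\in\{0,\dots,n\}$, and every solution of the scheme agrees with it almost surely. 3. For every solution of the scheme, the error $\sup_{a\le t\le b}\|z(t)-\bar l^{IE}(t)\|$ is almost everywhere equal to a measurable function, and $$\Bigl\|\sup_{a\le t\le b}\|z(t)-\bar l^{IE}(t)\|\Bigr\|_{L^p(\Omega)}\le C\bigl(h^{\min\{\varrho+\frac12,1\}}+\delta\bigr).$$ -/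

import Mathlib

open MeasureTheory ProbabilityTheory Set
open scoped ENNReal

noncomputable section

namespace RandEuler

/-- The space `ℝ^d` with the one norm `‖x‖ = ∑ k, |x k|`. -/
abbrev Vec (d : ℕ) : Type := PiLp 1 (fun _ : Fin d => ℝ)

/-- The class of initial-value problems `(η, f)` on `[a, b]`. A right-hand side is a function of
`(t, x)`, and only its values for `t ∈ [a, b]` matter. The radius `R` may be `∞`, in which case the
closed ball around `η` is the whole space. -/
structure IVPClass {d : ℕ} (a b ρ K L : ℝ) (R : ℝ≥0∞) (η : Vec d) (f : ℝ → Vec d → Vec d) :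
    Prop where
  norm_init : ‖η‖ ≤ K
  cont : ContinuousOn (fun q : ℝ × Vec d => f q.1 q.2) (Icc a b ×ˢ univ)
  growth : ∀ t ∈ Icc a b, ∀ x, ‖f t x‖ ≤ K * (1 + ‖x‖)
  holder : ∀ t ∈ Icc a b, ∀ s ∈ Icc a b, ∀ x ∈ Metric.closedEBall η R,
    ‖f t x - f s x‖ ≤ L * |t - s| ^ ρ
  lipschitz : ∀ t ∈ Icc a b, ∀ x ∈ Metric.closedEBall η R, ∀ y ∈ Metric.closedEBall η R,
    ‖f t x - f t y‖ ≤ L * ‖x - y‖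

/-- Borel measurable noise functions on `[a, b] × ℝ^d` of linear growth with constant `δ`. -/
structure NoiseK1 {d : ℕ} (a b δ : ℝ) (g : ℝ → Vec d → Vec d) : Prop where
  meas : Measurable (fun q : Icc a b × Vec d => g q.1 q.2)
  growth : ∀ t ∈ Icc a b, ∀ y, ‖g t y‖ ≤ δ * (1 + ‖y‖)

/-- Noise functions that are moreover `δ`-Lipschitz in the space variable. -/
structure NoiseK2 {d : ℕ} (a b δ : ℝ) (g : ℝ → Vec d → Vec d) : Prop
    extends NoiseK1 a b δ g where
  lipschitz : ∀ t ∈ Icc a b, ∀ x y, ‖g t x - g t y‖ ≤ δ * ‖x - y‖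

/-- `(η', f')` is noisy information about `(η, f)` with precision `δ`: `η'` lies in the closed ball
of radius `δ` around `η`, and `f'` is `f` plus a noise function of the class `NoiseK2` on
`[a, b] × ℝ^d`. -/
def NoisyInfo {d : ℕ} (a b δ : ℝ) (η : Vec d) (f : ℝ → Vec d → Vec d)
    (η' : Vec d) (f' : ℝ → Vec d → Vec d) : Prop :=
  η' ∈ Metric.closedBall η δ ∧
    ∃ g : ℝ → Vec d → Vec d, NoiseK2 a b δ g ∧ ∀ t ∈ Icc a b, ∀ x, f' t x = f t x + g t x

/-- `z` solves `z'(t) = f(t, z(t))` on `[a, b]`, `z(a) = η` (one-sided derivatives at the ends). -/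
def IsODESolution {d : ℕ} (a b : ℝ) (η : Vec d) (f : ℝ → Vec d → Vec d) (z : ℝ → Vec d) : Prop :=
  z a = η ∧ ∀ t ∈ Icc a b, HasDerivWithinAt z (f t (z t)) (Icc a b) t

/-- The step size `h = (b - a) / n`. -/
def step (a b : ℝ) (n : ℕ) : ℝ := (b - a) / n

/-- The grid points `t_j = a + j h`. -/
def node (a b : ℝ) (n j : ℕ) : ℝ := a + j * step a b n

/-- `U 0, …, U n` is a solution of the randomized implicit Euler scheme almost surely. The variable
`τ j` (for `j = 0, …, n - 1`) is used in the step from `U j` to `U (j + 1)`, at the random time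
`t_j + τ_j h`. The values `U j` for `j > n` are irrelevant. -/
def IsSchemeSolution {d : ℕ} {Ω : Type*} [MeasurableSpace Ω] (P : Measure Ω) (a b : ℝ) (n : ℕ)
    (τ : Fin n → Ω → ℝ) (η' : Vec d) (f' : ℝ → Vec d → Vec d) (U : ℕ → Ω → Vec d) : Prop :=
  ∀ᵐ ω ∂P, U 0 ω = η' ∧ ∀ j : Fin n,
    U (j + 1) ω =
      U j ω + step a b n • f' (node a b n j + τ j ω * step a b n) (U (j + 1) ω)

/-- The `σ`-algebra generated by the first `j` of the random variables `τ` and the null sets. -/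
@[reducible] def filt {Ω : Type*} [MeasurableSpace Ω] (P : Measure Ω) {n : ℕ} (τ : Fin n → Ω → ℝ) (j : ℕ) :
    MeasurableSpace Ω :=
  (⨆ i : {i : Fin n // (i : ℕ) < j}, MeasurableSpace.comap (τ i) inferInstance) ⊔
    MeasurableSpace.generateFrom {A | MeasurableSet A ∧ P A = 0}

/-- The piecewise linear function on `[a, b]` that interpolates the values `u 0, …, u n` at the
grid points (see `interp_eq`). -/
def interp {d : ℕ} (a b : ℝ) (n : ℕ) (u : ℕ → Vec d) (t : ℝ) : Vec d :=
  let j := ⌊(t - a) / step a b n⌋₊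
  u j + ((t - node a b n j) / step a b n) • (u (j + 1) - u j)

/-- The pathwise sup-in-time error `sup_{a ≤ t ≤ b} ‖z(t) - l(t)‖`, as an element of `[0, ∞]`. -/
def supError {d : ℕ} {Ω : Type*} (a b : ℝ) (n : ℕ) (z : ℝ → Vec d) (U : ℕ → Ω → Vec d) (ω : Ω) :
    ℝ≥0∞ :=
  ⨆ t ∈ Icc a b, ‖z t - interp a b n (fun j => U j ω) t‖ₑ

/-- On each grid interval `interp` is the affine function through the two end values. -/
theorem interp_eq {d : ℕ} {a b : ℝ} (hab : a < b) {n : ℕ} (hn : 0 < n) (u : ℕ → Vec d) (j : ℕ)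
    {t : ℝ} (ht : t ∈ Icc (node a b n j) (node a b n (j + 1))) :
    interp a b n u t =
      ((t - node a b n j) / step a b n) • (u (j + 1) - u j) + u j := by
  have hh : 0 < step a b n := by
    unfold step
    have : (0 : ℝ) < n := by exact_mod_cast hn
    exact div_pos (by linarith) this
  obtain ⟨h1, h2⟩ := ht
  rcases eq_or_lt_of_le h2 with h | h
  · have e : (t - a) / step a b n = ((j + 1 : ℕ) : ℝ) := by
      rw [h, node]; field_simp; ring
    have e2 : (t - node a b n j) / step a b n = 1 := by
      rw [h, node, node]; push_cast; field_simp; ring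
    rw [e2]
    simp only [interp, e, Nat.floor_natCast]
    rw [h]; simp
  · have e : ⌊(t - a) / step a b n⌋₊ = j := by
      unfold node at h1 h
      push_cast at h
      have h0 : (j : ℝ) ≤ (t - a) / step a b n := by rw [le_div_iff₀ hh]; linarith
      refine (Nat.floor_eq_iff (le_trans (Nat.cast_nonneg j) h0)).2 ⟨h0, ?_⟩
      rw [div_lt_iff₀ hh]; linarith
    simp only [interp, e]
    rw [add_comm]

end RandEuler

end

noncomputable section

namespace RandEuler

/-! Write `e k` for the error at the `k`-th grid point and `S k` for the sum of the first `k` errors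
of the one-point random quadrature `h f(θ, z(θ))` for the increments of `z`. In `e k + S k` the
increments of `z` cancel, and one step changes this sum only by `h (f(θ, z(θ)) - f'(θ, U))`, where
`U` is the new value. The bracket is `O(h + δ)` plus a Lipschitz term in the new error. The
step-size conditions keep `h (L + δ)` uniformly below `1`, so the implicit term can be absorbed, and
a discrete Gronwall argument gives, path by path, an error `O(h + δ + max ‖S k‖)`
(`norm_sub_le_gridErrorConst`).

It remains to bound the maximum in `L^p`. For fixed `z` the quadrature errors are functions of the
individual `τ j`, hence independent. They have mean zero, because a uniform sample integrates `z'`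
exactly in expectation, and size `O(h^(ρ + 1))` by the regularity of `f`
(`integral_quadError_eq_zero`, `norm_quadError_le`). Doob's inequality for exponential
submartingales and Hoeffding's lemma give Gaussian tails at scale `√n h^(ρ + 1)`, that is `h^(ρ +
1/2)`, and so all moments (`eLpNorm_maxPartialSum_le`). Interpolation between grid points costs
another `O(h)`.

Existence, uniqueness and adaptedness for the scheme come from the contraction principle with
measurable dependence on parameters. -/

/-- The sum of the terms of a finite sequence with index below `k`. -/
def partialSum {n : ℕ} {E : Type*} [AddCommMonoid E] (x : Fin n → E) (k : ℕ) : E :=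
  ∑ i ∈ Finset.univ.filter (fun i : Fin n => (i : ℕ) < k), x i

theorem partialSum_zero {n : ℕ} {E : Type*} [AddCommMonoid E] (x : Fin n → E) :
    partialSum x 0 = 0 := by
  simp [partialSum]

theorem partialSum_succ {n : ℕ} {E : Type*} [AddCommMonoid E] (x : Fin n → E) (k : Fin n) :
    partialSum x (k + 1) = partialSum x k + x k := by
  have : Finset.univ.filter (fun i : Fin n => (i : ℕ) < k + 1) =
      insert k (Finset.univ.filter (fun i : Fin n => (i : ℕ) < k)) := by
    ext i
    simp only [Finset.mem_filter, Finset.mem_univ, true_and, Finset.mem_insert, Fin.ext_iff]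
    omega
  rw [partialSum, this, Finset.sum_insert (by simp), add_comm, partialSum]

theorem partialSum_succ_of_le {n : ℕ} {E : Type*} [AddCommMonoid E] (x : Fin n → E) {k : ℕ}
    (hk : n ≤ k) : partialSum x (k + 1) = partialSum x k := by
  unfold partialSum
  congr 1
  ext i
  have := i.2
  simp only [Finset.mem_filter, Finset.mem_univ, true_and]
  omega

/-! ### Maximal inequality for sums of bounded independent variables -/

section Maximal

variable {Ω : Type*} [MeasurableSpace Ω] {P : Measure Ω} [IsProbabilityMeasure P] {n : ℕ}
  {X : Fin n → Ω → ℝ}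

/-- The filtration generated by a finite sequence of random variables, in which the `σ`-algebra
with index `k` is generated by the first `k` of them. -/
def prefixFiltration (hX : ∀ i, Measurable (X i)) : Filtration ℕ (inferInstance : MeasurableSpace Ω) where
  seq k := ⨆ i ∈ {i : Fin n | (i : ℕ) < k}, MeasurableSpace.comap (X i) inferInstance
  mono' _ _ hkl := iSup₂_mono' fun i hi => ⟨i, lt_of_lt_of_le hi hkl, le_rfl⟩
  le' _ := iSup₂_le fun i _ => (hX i).comap_le

theorem measurable_partialSum (hX : ∀ i, Measurable (X i)) (k : ℕ) :
    Measurable[prefixFiltration hX k] fun ω => partialSum (fun i => X i ω) k := by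
  unfold partialSum
  refine Finset.measurable_fun_sum (m := prefixFiltration hX k) _ fun i hi => ?_
  refine measurable_iff_comap_le.2 ?_
  exact le_iSup₂_of_le (f := fun i (_ : i ∈ {i : Fin n | (i : ℕ) < k}) =>
    MeasurableSpace.comap (X i) inferInstance) i (by simpa using hi) le_rfl

theorem one_le_mgf_of_integral_eq_zero {Y : Ω → ℝ} {t : ℝ}
    (hY : Integrable Y P) (he : Integrable (fun ω => Real.exp (t * Y ω)) P) (h0 : ∫ ω, Y ω ∂P = 0) :
    1 ≤ ∫ ω, Real.exp (t * Y ω) ∂P := by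
  calc (1 : ℝ) = ∫ ω, (t * Y ω + 1) ∂P := by
        rw [integral_add (hY.const_mul t) (integrable_const _), integral_const_mul, h0]
        simp
    _ ≤ _ := integral_mono ((hY.const_mul t).add (integrable_const _)) he
        fun ω => Real.add_one_le_exp _

/-- Given the past, the next factor `exp (t * X k)` is independent with expectation at least `1`,
because `X k` is centred. From index `n` on, the sums no longer change. -/
theorem submartingale_exp_partialSum (hX : ∀ i, Measurable (X i)) (hind : iIndepFun X P)
    {s : NNReal} (hsub : ∀ i, HasSubgaussianMGF (X i) s P) (h0 : ∀ i, ∫ ω, X i ω ∂P = 0) (t : ℝ) :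
    Submartingale (fun k ω => Real.exp (t * partialSum (fun i => X i ω) k))
      (prefixFiltration hX) P := by
  have hint (k : ℕ) : Integrable (fun ω => Real.exp (t * partialSum (fun i => X i ω) k)) P :=
    (HasSubgaussianMGF.sum_of_iIndepFun hind (c := fun _ => s)
      (s := Finset.univ.filter (fun i : Fin n => (i : ℕ) < k))
      fun i _ => hsub i).integrable_exp_mul t
  have hadp (k : ℕ) : StronglyMeasurable[prefixFiltration hX k]
      fun ω => Real.exp (t * partialSum (fun i => X i ω) k) :=
    (Real.measurable_exp.comp ((measurable_partialSum hX k).const_mul t)).stronglyMeasurable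
  refine submartingale_nat hadp hint fun k => ?_
  rcases lt_or_ge k n with hk | hk
  · have e : (fun ω => Real.exp (t * partialSum (fun i => X i ω) (k + 1))) =
        (fun ω => Real.exp (t * partialSum (fun i => X i ω) k)) *
          fun ω => Real.exp (t * X ⟨k, hk⟩ ω) := by
      funext ω
      have := partialSum_succ (fun i => X i ω) ⟨k, hk⟩
      simp only at this
      rw [this, mul_add, Real.exp_add, Pi.mul_apply]
    have he := (hsub ⟨k, hk⟩).integrable_exp_mul t
    have h1 := condExp_mul_of_stronglyMeasurable_left (hadp k) (e ▸ hint (k + 1)) he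
    have hindep : Indep (MeasurableSpace.comap (X ⟨k, hk⟩) inferInstance)
        (prefixFiltration hX k) P := by
      have := indep_iSup_of_disjoint (fun i => (hX i).comap_le) hind
        (S := {⟨k, hk⟩}) (T := {i : Fin n | (i : ℕ) < k}) (by simp)
      rw [iSup_singleton] at this
      exact this
    have h2 := condExp_indep_eq (hX ⟨k, hk⟩).comap_le ((prefixFiltration hX).le k)
      (f := fun ω => Real.exp (t * X ⟨k, hk⟩ ω))
      ((Real.measurable_exp.comp ((comap_measurable (X ⟨k, hk⟩)).const_mul t)).stronglyMeasurable)
      hindep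
    rw [e]
    filter_upwards [h1, h2] with ω hω1 hω2
    rw [hω1, Pi.mul_apply, hω2]
    exact le_mul_of_one_le_right (Real.exp_pos _).le
      (one_le_mgf_of_integral_eq_zero (hsub _).integrable he (h0 _))
  · have e : (fun ω => Real.exp (t * partialSum (fun i => X i ω) (k + 1))) =
        fun ω => Real.exp (t * partialSum (fun i => X i ω) k) := by
      funext ω
      rw [partialSum_succ_of_le _ hk]
    rw [e, condExp_of_stronglyMeasurable ((prefixFiltration hX).le k) (hadp k) (hint k)]

/-- Doob's maximal inequality for the exponential submartingale, whose last expectation Hoeffding's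
lemma bounds by `exp (n c² t² / 2)`. -/
theorem measure_exists_partialSum_ge_le (hX : ∀ i, Measurable (X i)) (hind : iIndepFun X P)
    {c : ℝ} (hc : 0 < c) (hn : 0 < n) (hb : ∀ i, ∀ᵐ ω ∂P, |X i ω| ≤ c)
    (h0 : ∀ i, ∫ ω, X i ω ∂P = 0) {x : ℝ} (hx : 0 ≤ x) :
    P {ω | ∃ k ≤ n, x ≤ partialSum (fun i => X i ω) k} ≤
      ENNReal.ofReal (Real.exp (-(x ^ 2 / (2 * n * c ^ 2)))) := by
  have hsub (i : Fin n) : HasSubgaussianMGF (X i) ((‖c - -c‖₊ / 2) ^ 2) P :=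
    hasSubgaussianMGF_of_mem_Icc_of_integral_eq_zero (hX i).aemeasurable
      ((hb i).mono fun ω h => abs_le.1 h) (h0 i)
  have hs : (((‖c - -c‖₊ / 2) ^ 2 : NNReal) : ℝ) = c ^ 2 := by
    push_cast
    rw [Real.norm_eq_abs, abs_of_nonneg (by linarith)]
    ring
  have hn' : (0 : ℝ) < n := by exact_mod_cast hn
  -- This `t` minimises the exponent `n c² t² / 2 - t x` of the Chernoff bound.
  set t : ℝ := x / (n * c ^ 2) with ht
  have ht0 : 0 ≤ t := by positivity
  have hM := maximal_ineq (submartingale_exp_partialSum hX hind hsub h0 t)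
    (fun k ω => (Real.exp_pos _).le) (ε := (Real.exp (t * x)).toNNReal) n
  rw [Real.coe_toNNReal _ (Real.exp_pos _).le] at hM
  have hS := HasSubgaussianMGF.sum_of_iIndepFun hind (s := Finset.univ) fun i _ => hsub i
  have e : (fun ω => Real.exp (t * partialSum (fun i => X i ω) n)) =
      fun ω => Real.exp (t * ∑ i, X i ω) := by
    funext ω
    simp [partialSum]
  have hbound : ∫ ω, Real.exp (t * partialSum (fun i => X i ω) n) ∂P ≤
      Real.exp (n * c ^ 2 * t ^ 2 / 2) := by
    rw [e]
    have := hS.mgf_le t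
    simp only [mgf, NNReal.coe_sum, hs] at this
    simpa using this
  set A := {ω | ∃ k ≤ n, x ≤ partialSum (fun i => X i ω) k} with hA
  have hAsub : P A ≤ P {ω | Real.exp (t * x) ≤ (Finset.range (n + 1)).sup'
      Finset.nonempty_range_add_one fun k => Real.exp (t * partialSum (fun i => X i ω) k)} := by
    refine measure_mono fun ω ⟨k, hk, h⟩ => ?_
    rw [mem_ofPred_eq, Finset.le_sup'_iff]
    exact ⟨k, Finset.mem_range.2 (Nat.lt_succ_of_le hk),
      Real.exp_le_exp.2 (mul_le_mul_of_nonneg_left h ht0)⟩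
  have hfin : ENNReal.ofReal (Real.exp (t * x)) * P A ≤
      ENNReal.ofReal (Real.exp (n * c ^ 2 * t ^ 2 / 2)) := by
    refine (mul_le_mul_right hAsub _).trans (hM.trans (ENNReal.ofReal_le_ofReal ?_))
    refine le_trans (setIntegral_le_integral ?_ (Filter.Eventually.of_forall
      fun ω => (Real.exp_pos _).le)) hbound
    rw [e]
    exact hS.integrable_exp_mul t
  have hpos : ENNReal.ofReal (Real.exp (t * x)) ≠ 0 := by
    simp [Real.exp_pos]
  rw [mul_comm, ← ENNReal.le_div_iff_mul_le (Or.inl hpos) (Or.inl ENNReal.ofReal_ne_top),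
    ← ENNReal.ofReal_div_of_pos (Real.exp_pos _), ← Real.exp_sub] at hfin
  convert hfin using 3
  rw [ht]
  field_simp
  ring

end Maximal

/-! ### Moments of the maximal partial sum -/

/-- The largest absolute value of the partial sums of a finite real sequence. -/
def maxPartialSum {n : ℕ} (x : Fin n → ℝ) : ℝ :=
  (Finset.range (n + 1)).sup' Finset.nonempty_range_add_one fun k => |partialSum x k|

theorem abs_partialSum_le_maxPartialSum {n : ℕ} (x : Fin n → ℝ) {k : ℕ} (hk : k ≤ n) :
    |partialSum x k| ≤ maxPartialSum x :=
  Finset.le_sup' (fun k => |partialSum x k|) (Finset.mem_range.2 (Nat.lt_succ_of_le hk))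

theorem maxPartialSum_nonneg {n : ℕ} (x : Fin n → ℝ) : 0 ≤ maxPartialSum x :=
  (abs_nonneg _).trans (abs_partialSum_le_maxPartialSum x (Nat.zero_le n))

theorem measurable_maxPartialSum {Ω : Type*} [MeasurableSpace Ω] {n : ℕ} {X : Fin n → Ω → ℝ}
    (hX : ∀ i, Measurable (X i)) : Measurable fun ω => maxPartialSum fun i => X i ω := by
  unfold maxPartialSum partialSum
  refine Finset.measurable_range_sup'' fun k _ => ?_
  fun_prop

/-- The `p`-th root of the `p`-th moment of a nonnegative variable with tail `2 exp (-t² / 2)`. -/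
def momentConst (p : ℝ) : ℝ≥0∞ :=
  (ENNReal.ofReal p * ∫⁻ t in Ioi 0,
    2 * ENNReal.ofReal (Real.exp (-(t ^ 2 / 2))) * ENNReal.ofReal (t ^ (p - 1))) ^ (1 / p)

theorem momentConst_ne_top {p : ℝ} (hp : 0 < p) : momentConst p ≠ ∞ := by
  have h := (integrableOn_rpow_mul_exp_neg_mul_sq (b := 1 / 2) (by norm_num)
    (s := p - 1) (by linarith)).const_mul 2
  have h2 : ∫⁻ t in Ioi (0 : ℝ),
      2 * ENNReal.ofReal (Real.exp (-(t ^ 2 / 2))) * ENNReal.ofReal (t ^ (p - 1)) < ∞ := by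
    have h3 := h.lintegral_lt_top
    convert h3 using 3 with t
    rw [show (-(t ^ 2 / 2)) = -(1 / 2) * t ^ 2 by ring, ← ENNReal.ofReal_ofNat 2,
      ← ENNReal.ofReal_mul (by norm_num), ← ENNReal.ofReal_mul (by positivity)]
    congr 1
    ring
  exact (ENNReal.rpow_lt_top_of_nonneg (by positivity)
    (ENNReal.mul_lt_top ENNReal.ofReal_lt_top h2).ne).ne

/-- Layer-cake formula: the `p`-th moment is `p` times the integral of the tail against `t ^ (p -
1)`. -/
theorem eLpNorm_le_momentConst {Ω : Type*} [MeasurableSpace Ω] {P : Measure Ω} {p : ℝ}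
    (hp : 0 < p) {f : Ω → ℝ} (hf : Measurable f) (hf0 : ∀ ω, 0 ≤ f ω)
    (htail : ∀ t, 0 < t → P {ω | t ≤ f ω} ≤ 2 * ENNReal.ofReal (Real.exp (-(t ^ 2 / 2)))) :
    eLpNorm f (ENNReal.ofReal p) P ≤ momentConst p := by
  rw [eLpNorm_eq_lintegral_rpow_enorm_toReal (by simpa using hp) ENNReal.ofReal_ne_top,
    ENNReal.toReal_ofReal hp.le, momentConst]
  refine ENNReal.rpow_le_rpow ?_ (by positivity)
  have e : ∫⁻ ω, ‖f ω‖ₑ ^ p ∂P = ∫⁻ ω, ENNReal.ofReal (f ω ^ p) ∂P := by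
    refine lintegral_congr fun ω => ?_
    rw [Real.enorm_of_nonneg (hf0 ω), ENNReal.ofReal_rpow_of_nonneg (hf0 ω) hp.le]
  rw [e, lintegral_rpow_eq_lintegral_meas_le_mul P (Filter.Eventually.of_forall hf0)
    hf.aemeasurable hp]
  refine mul_le_mul_right (setLIntegral_mono' measurableSet_Ioi fun t ht => ?_) _
  exact mul_le_mul_left (htail t ht) _

/-- Division by `c √n` turns the tail into `2 exp (-t² / 2)`, free of `n` and `c`; the factor `2`
comes from applying the one-sided bound to `X` and to `-X`. -/
theorem eLpNorm_maxPartialSum_le {Ω : Type*} [MeasurableSpace Ω] {P : Measure Ω}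
    [IsProbabilityMeasure P] {n : ℕ} {X : Fin n → Ω → ℝ} (hX : ∀ i, Measurable (X i))
    (hind : iIndepFun X P) {c : ℝ} (hc : 0 < c) (hn : 0 < n) (hb : ∀ i, ∀ᵐ ω ∂P, |X i ω| ≤ c)
    (h0 : ∀ i, ∫ ω, X i ω ∂P = 0) {p : ℝ} (hp : 0 < p) :
    eLpNorm (fun ω => maxPartialSum fun i => X i ω) (ENNReal.ofReal p) P ≤
      ENNReal.ofReal (c * √n) * momentConst p := by
  have hn' : (0 : ℝ) < n := by exact_mod_cast hn
  have hσ : 0 < c * √n := mul_pos hc (Real.sqrt_pos.2 hn')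
  set σ := c * √n with hσd
  have e : (fun ω => maxPartialSum fun i => X i ω) =
      σ • fun ω => σ⁻¹ * maxPartialSum fun i => X i ω := by
    funext ω
    simp only [Pi.smul_apply, smul_eq_mul]
    field_simp
  rw [e, eLpNorm_const_smul, Real.enorm_of_nonneg hσ.le]
  refine mul_le_mul_right (eLpNorm_le_momentConst hp ((measurable_maxPartialSum hX).const_mul _)
    (fun ω => mul_nonneg (inv_nonneg.2 hσ.le) (maxPartialSum_nonneg _)) fun t ht => ?_) _
  have hexp : (t * σ) ^ 2 / (2 * n * c ^ 2) = t ^ 2 / 2 := by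
    rw [hσd, mul_pow, mul_pow, Real.sq_sqrt hn'.le]
    field_simp
  have h1 := measure_exists_partialSum_ge_le hX hind hc hn hb h0 (x := t * σ) (by positivity)
  have h2 := measure_exists_partialSum_ge_le (X := fun i ω => -X i ω) (fun i => (hX i).neg)
    (hind.comp (fun _ x => -x) fun _ => measurable_neg) hc hn
    (fun i => (hb i).mono fun ω h => by rwa [abs_neg])
    (fun i => by rw [integral_neg, h0, neg_zero]) (x := t * σ) (by positivity)
  rw [hexp] at h1 h2
  rw [two_mul]
  refine le_trans (measure_mono ?_) ((measure_union_le _ _).trans (add_le_add h1 h2))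
  intro ω hω
  have hω' : t * σ ≤ maxPartialSum fun i => X i ω := by
    have : t ≤ σ⁻¹ * maxPartialSum fun i => X i ω := hω
    rwa [le_inv_mul_iff₀ hσ, mul_comm] at this
  obtain ⟨k, hk, h⟩ := (Finset.le_sup'_iff _).1 hω'
  have hk' : k ≤ n := Nat.lt_succ_iff.1 (Finset.mem_range.1 hk)
  rcases le_abs.1 h with h | h
  · exact Or.inl ⟨k, hk', h⟩
  · refine Or.inr ⟨k, hk', ?_⟩
    simpa [partialSum] using h

/-! ### The initial-value problem: a priori bounds, uniqueness, existence -/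

section ODE

variable {d : ℕ} {a b ρ K L : ℝ} {η : Vec d} {f : ℝ → Vec d → Vec d} {z : ℝ → Vec d}

theorem Vec.norm_eq_sum_abs (x : Vec d) : ‖x‖ = ∑ i, |x i| := by
  simp [PiLp.norm_eq_of_L1]

theorem IVPClass.lipschitz_univ (hf : IVPClass a b ρ K L ∞ η f) {t : ℝ} (ht : t ∈ Icc a b)
    (x y : Vec d) : ‖f t x - f t y‖ ≤ L * ‖x - y‖ :=
  hf.lipschitz t ht x (Metric.mem_closedEBall.2 le_top) y (Metric.mem_closedEBall.2 le_top)

theorem IVPClass.holder_univ (hf : IVPClass a b ρ K L ∞ η f) {t s : ℝ} (ht : t ∈ Icc a b)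
    (hs : s ∈ Icc a b) (x : Vec d) : ‖f t x - f s x‖ ≤ L * |t - s| ^ ρ :=
  hf.holder t ht s hs x (Metric.mem_closedEBall.2 le_top)

theorem IsODESolution.continuousOn (hz : IsODESolution a b η f z) : ContinuousOn z (Icc a b) :=
  fun t ht => (hz.2 t ht).continuousWithinAt

theorem IsODESolution.hasDerivWithinAt_Ici (hz : IsODESolution a b η f z) {t : ℝ}
    (ht : t ∈ Ico a b) : HasDerivWithinAt z (f t (z t)) (Ici t) t :=
  (hz.2 t (Ico_subset_Icc_self ht)).mono_of_mem_nhdsWithin (Icc_mem_nhdsGE_of_mem ht)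

/-- The a priori bound for solutions of initial-value problems of linear growth. -/
def solutionBound (a b K : ℝ) : ℝ := gronwallBound K K K (b - a)

theorem solutionBound_nonneg (hab : a < b) (hK : 0 < K) : 0 ≤ solutionBound a b K := by
  have h := gronwallBound_mono hK.le hK.le hK.le (sub_pos.2 hab).le
  rw [gronwallBound_x0] at h
  exact hK.le.trans h

theorem IsODESolution.norm_le (hK : 0 < K) (hz : IsODESolution a b η f z) (hη : ‖η‖ ≤ K)
    (hf : ∀ t ∈ Icc a b, ∀ x, ‖f t x‖ ≤ K * (1 + ‖x‖)) {t : ℝ} (ht : t ∈ Icc a b) :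
    ‖z t‖ ≤ solutionBound a b K := by
  refine (norm_le_gronwallBound_of_norm_deriv_right_le hz.continuousOn
    (fun x hx => hz.hasDerivWithinAt_Ici hx) (hz.1 ▸ hη) (fun x hx => ?_) t ht).trans
    (gronwallBound_mono hK.le hK.le hK.le (by linarith [ht.2]))
  have := hf x (Ico_subset_Icc_self hx) (z x)
  linarith

theorem IsODESolution.norm_sub_le (hK : 0 < K) (hz : IsODESolution a b η f z) (hη : ‖η‖ ≤ K)
    (hf : ∀ t ∈ Icc a b, ∀ x, ‖f t x‖ ≤ K * (1 + ‖x‖)) {s t : ℝ} (hs : s ∈ Icc a b)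
    (ht : t ∈ Icc a b) : ‖z t - z s‖ ≤ K * (1 + solutionBound a b K) * |t - s| := by
  refine (convex_Icc a b).norm_image_sub_le_of_norm_hasDerivWithin_le hz.2 (fun x hx => ?_) hs ht
  exact (hf x hx _).trans (mul_le_mul_of_nonneg_left
    (by linarith [hz.norm_le hK hη hf hx]) hK.le)

theorem IsODESolution.eqOn (hL : 0 < L) (hz : IsODESolution a b η f z)
    (hf : ∀ t ∈ Icc a b, ∀ x y, ‖f t x - f t y‖ ≤ L * ‖x - y‖) {z' : ℝ → Vec d}
    (hz' : IsODESolution a b η f z') : EqOn z' z (Icc a b) := by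
  refine ODE_solution_unique_of_mem_Icc_right (K := L.toNNReal) (s := fun _ => univ) (v := f)
    (fun t ht => LipschitzOnWith.of_dist_le_mul fun x _ y _ => ?_) hz'.continuousOn
    (fun t ht => hz'.hasDerivWithinAt_Ici ht) (fun _ _ => mem_univ _) hz.continuousOn
    (fun t ht => hz.hasDerivWithinAt_Ici ht) (fun _ _ => mem_univ _) (hz'.1.trans hz.1.symm)
  rw [dist_eq_norm, dist_eq_norm, Real.coe_toNNReal _ hL.le]
  exact hf t (Ico_subset_Icc_self ht) x y

/-- The coordinatewise projection onto the cube `[-R, R] ^ d`. -/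
def clamp (R : ℝ) (x : Vec d) : Vec d := WithLp.toLp 1 fun i => max (-R) (min R (x i))

theorem norm_clamp_sub_clamp_le (R : ℝ) (x y : Vec d) : ‖clamp R x - clamp R y‖ ≤ ‖x - y‖ := by
  rw [Vec.norm_eq_sum_abs, Vec.norm_eq_sum_abs]
  refine Finset.sum_le_sum fun i _ => ?_
  simp only [clamp, PiLp.sub_apply]
  refine (abs_max_sub_max_le_max _ _ _ _).trans (max_le (by simp) ?_)
  exact (abs_min_sub_min_le_max _ _ _ _).trans (max_le (by simp) le_rfl)

theorem norm_clamp_le {R : ℝ} (hR : 0 ≤ R) (x : Vec d) : ‖clamp R x‖ ≤ ‖x‖ := by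
  have h0 : clamp R (0 : Vec d) = 0 := by
    ext i
    simp [clamp, hR]
  simpa [h0] using norm_clamp_sub_clamp_le R x 0

theorem norm_clamp_le_card_mul {R : ℝ} (hR : 0 ≤ R) (x : Vec d) : ‖clamp R x‖ ≤ d * R := by
  rw [Vec.norm_eq_sum_abs]
  refine (Finset.sum_le_card_nsmul _ _ R fun i _ => ?_).trans (by simp)
  exact abs_le.2 ⟨le_max_left _ _, max_le (by linarith) (min_le_left _ _)⟩

theorem clamp_eq_self {R : ℝ} {x : Vec d} (hx : ‖x‖ ≤ R) : clamp R x = x := by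
  ext i
  rw [Vec.norm_eq_sum_abs] at hx
  have h := abs_le.1 ((Finset.single_le_sum (f := fun i => |x i|) (fun i _ => abs_nonneg _)
    (Finset.mem_univ i)).trans hx)
  simp only [clamp]
  rw [min_eq_right h.2, max_eq_right h.1]

/-- Clamping the space variable makes the right-hand side bounded, so Picard–Lindelöf reaches all of
`[a, b]` at once. Clamping is `1`-Lipschitz in the one norm and preserves the growth condition, so
Gronwall keeps the solution where the clamp is the identity. -/
theorem IVPClass.exists_isODESolution (hab : a < b) (hK : 0 < K) (hL : 0 < L)
    (hf : IVPClass a b ρ K L ∞ η f) : ∃ z, IsODESolution a b η f z := by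
  set R := solutionBound a b K
  have hR : 0 ≤ R := solutionBound_nonneg hab hK
  have hPL : IsPicardLindelof (fun t x => f t (clamp R x))
      (⟨a, left_mem_Icc.2 hab.le⟩ : Icc a b) η (K * (1 + d * R) * (b - a)).toNNReal 0
      (K * (1 + d * R)).toNNReal L.toNNReal := by
    refine ⟨fun t ht => LipschitzOnWith.of_dist_le_mul fun x _ y _ => ?_, fun x _ => ?_,
      fun t ht x _ => ?_, ?_⟩
    · rw [dist_eq_norm, dist_eq_norm, Real.coe_toNNReal _ hL.le]
      exact (hf.lipschitz_univ ht _ _).trans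
        (mul_le_mul_of_nonneg_left (norm_clamp_sub_clamp_le R x y) hL.le)
    · exact hf.cont.comp (continuousOn_id.prodMk continuousOn_const) fun t ht => ⟨ht, mem_univ _⟩
    · rw [Real.coe_toNNReal _ (by positivity)]
      exact (hf.growth t ht _).trans (mul_le_mul_of_nonneg_left
        (by linarith [norm_clamp_le_card_mul hR x]) hK.le)
    · have hba := (sub_pos.2 hab).le
      rw [Real.coe_toNNReal _ (by positivity), Real.coe_toNNReal _ (by positivity)]
      simp [hba]
  obtain ⟨z, hz0, hz⟩ := hPL.exists_eq_forall_mem_Icc_hasDerivWithinAt₀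
  have hz' : IsODESolution a b η (fun t x => f t (clamp R x)) z := ⟨hz0, hz⟩
  refine ⟨z, hz0, fun t ht => ?_⟩
  have hb : ‖z t‖ ≤ R := hz'.norm_le hK hf.norm_init (fun t ht x => (hf.growth t ht _).trans
    (mul_le_mul_of_nonneg_left (by linarith [norm_clamp_le hR x]) hK.le)) ht
  have h := hz t ht
  rwa [clamp_eq_self hb] at h

end ODE

/-! ### Measurable solution of one implicit step -/

section ImplicitStep

variable {d : ℕ} {a b h Λ : ℝ} {F : ℝ → Vec d → Vec d}

/-- The step equation is a fixed-point problem for a contraction. Its solution is the pointwise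
limit of the iterates started at `0`, each of which is jointly measurable in the time and the old
value. -/
theorem exists_measurable_implicit_step (hh : 0 ≤ h) (hΛ : 0 ≤ Λ) (hhΛ : h * Λ < 1)
    (hmeas : Measurable fun q : Icc a b × Vec d => F q.1 q.2)
    (hlip : ∀ t ∈ Icc a b, ∀ x y, ‖F t x - F t y‖ ≤ Λ * ‖x - y‖) :
    ∃ Φ : Icc a b × Vec d → Vec d, Measurable Φ ∧
      ∀ (t : Icc a b) (u x : Vec d), x = u + h • F t x ↔ x = Φ (t, u) := by
  set G : Icc a b × Vec d → Vec d → Vec d := fun q x => q.2 + h • F q.1 x with hG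
  have hc (q : Icc a b × Vec d) : ContractingWith (h * Λ).toNNReal (G q) := by
    refine ⟨by simpa using hhΛ, LipschitzWith.of_dist_le_mul fun x y => ?_⟩
    rw [dist_eq_norm, dist_eq_norm, Real.coe_toNNReal _ (mul_nonneg hh hΛ)]
    simp only [hG, add_sub_add_left_eq_sub, ← smul_sub]
    rw [norm_smul, Real.norm_of_nonneg hh, mul_assoc]
    exact mul_le_mul_of_nonneg_left (hlip _ q.1.2 x y) hh
  refine ⟨fun q => (hc q).fixedPoint, ?_, fun t u x => ⟨fun hx => ?_, fun hx => ?_⟩⟩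
  · have hit (k : ℕ) : Measurable fun q : Icc a b × Vec d => (G q)^[k] 0 := by
      induction k with
      | zero => exact measurable_const
      | succ k ih =>
        simp only [Function.iterate_succ_apply']
        exact measurable_snd.add ((hmeas.comp (measurable_fst.prodMk ih)).const_smul h)
    exact measurable_of_tendsto_metrizable hit
      (tendsto_pi_nhds.2 fun q => (hc q).tendsto_iterate_fixedPoint 0)
  · exact (hc (t, u)).fixedPoint_unique hx.symm
  · rw [hx]
    exact (hc (t, u)).fixedPoint_isFixedPt.symm

end ImplicitStep

/-! ### Solvability and adaptedness of the scheme -/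

section Scheme

variable {d : ℕ} {a b ρ K L δ : ℝ} {η η' : Vec d} {f f' : ℝ → Vec d → Vec d} {n : ℕ}

theorem step_pos (hab : a < b) (hn : 0 < n) : 0 < step a b n :=
  div_pos (sub_pos.2 hab) (by exact_mod_cast hn)

theorem mul_step (hn : 0 < n) : n * step a b n = b - a := by
  have : (n : ℝ) ≠ 0 := by exact_mod_cast hn.ne'
  unfold step
  field_simp

theorem node_succ (j : ℕ) : node a b n (j + 1) = node a b n j + step a b n := by
  unfold node
  push_cast
  ring

theorem node_mem_Icc (hab : a < b) (hn : 0 < n) {j : ℕ} (hj : j ≤ n) :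
    node a b n j ∈ Icc a b := by
  have hh := step_pos hab hn
  have h1 : (j : ℝ) * step a b n ≤ n * step a b n :=
    mul_le_mul_of_nonneg_right (by exact_mod_cast hj) hh.le
  rw [mul_step hn] at h1
  have h2 : (0 : ℝ) ≤ j * step a b n := by positivity
  constructor <;> unfold node <;> linarith

theorem sample_mem_Icc_node (hab : a < b) (hn : 0 < n) (j : ℕ) {s : ℝ}
    (hs : s ∈ Icc (0 : ℝ) 1) :
    node a b n j + s * step a b n ∈ Icc (node a b n j) (node a b n (j + 1)) := by
  have hh := step_pos hab hn
  rw [node_succ]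
  constructor <;> nlinarith [hs.1, hs.2]

theorem Icc_node_subset (hab : a < b) (hn : 0 < n) (j : Fin n) :
    Icc (node a b n j) (node a b n (j + 1)) ⊆ Icc a b :=
  Icc_subset_Icc (node_mem_Icc hab hn j.2.le).1 (node_mem_Icc hab hn j.2).2

theorem NoisyInfo.measurable (hf : IVPClass a b ρ K L ∞ η f) (h : NoisyInfo a b δ η f η' f') :
    Measurable fun q : Icc a b × Vec d => f' q.1 q.2 := by
  obtain ⟨-, g, hg, hfg⟩ := h
  have e : (fun q : Icc a b × Vec d => f' q.1 q.2) = fun q => f q.1 q.2 + g q.1 q.2 :=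
    funext fun q => hfg _ q.1.2 _
  rw [e]
  refine Measurable.add (Continuous.measurable ?_) hg.meas
  exact hf.cont.comp_continuous (f := fun q : Icc a b × Vec d => ((q.1 : ℝ), q.2))
    (by fun_prop) fun q => ⟨q.1.2, mem_univ _⟩

theorem NoisyInfo.lipschitz (hf : IVPClass a b ρ K L ∞ η f) (h : NoisyInfo a b δ η f η' f')
    {t : ℝ} (ht : t ∈ Icc a b) (x y : Vec d) :
    ‖f' t x - f' t y‖ ≤ (L + δ) * ‖x - y‖ := by
  obtain ⟨-, g, hg, hfg⟩ := h
  rw [hfg t ht, hfg t ht, add_sub_add_comm, add_mul]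
  exact norm_add_le_of_le (hf.lipschitz_univ ht x y) (hg.lipschitz t ht x y)

/-- The conditions give `h L ≤ 1/2` and `h δ ≤ h ≤ 1 / (2 (K + 1))`, which leaves a gap to `1` that
depends on `K` alone. -/
theorem mul_add_le_of_step_le {h : ℝ} (hh : 0 ≤ h) (hK : 0 < K) (hδ : δ ≤ 1)
    (h1 : h * (K + 1) ≤ 1 / 2) (h2 : h * L ≤ 1 / 2) :
    h * (L + δ) ≤ 1 - K / (2 * (K + 1)) := by
  have h3 : h ≤ 1 / (2 * (K + 1)) := by
    rw [le_div_iff₀ (by positivity)]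
    linarith
  have h4 : K / (2 * (K + 1)) = 1 / 2 - 1 / (2 * (K + 1)) := by
    field_simp
    ring
  have h5 : h * δ ≤ h := mul_le_of_le_one_right hh hδ
  linarith

variable {Ω : Type*} [MeasurableSpace Ω] {P : Measure Ω} {τ : Fin n → Ω → ℝ}

theorem ae_mem_of_isUniform [IsProbabilityMeasure P] (hτ : ∀ j, Measurable (τ j))
    (hu : ∀ j, pdf.IsUniform (τ j) (Icc 0 1) P volume) :
    ∀ᵐ ω ∂P, ∀ j, τ j ω ∈ Icc (0 : ℝ) 1 := by
  refine ae_all_iff.2 fun j => ?_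
  refine ae_of_ae_map (hτ j).aemeasurable ?_
  rw [hu j]
  exact ae_cond_mem measurableSet_Icc

theorem measurable_filt_of_lt {i : Fin n} {j : ℕ} (hij : (i : ℕ) < j) :
    Measurable[filt P τ j] (τ i) := by
  refine measurable_iff_comap_le.2 (le_sup_of_le_left ?_)
  exact le_iSup (fun i : {i : Fin n // (i : ℕ) < j} => MeasurableSpace.comap (τ i) inferInstance)
    ⟨i, hij⟩

theorem filt_mono {j k : ℕ} (hjk : j ≤ k) : filt P τ j ≤ filt P τ k := by
  refine sup_le (iSup_le fun i => ?_) le_sup_right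
  exact measurable_iff_comap_le.1 (measurable_filt_of_lt (i.2.trans_le hjk))

theorem filt_le (hτ : ∀ j, Measurable (τ j)) (j : ℕ) :
    filt P τ j ≤ (inferInstance : MeasurableSpace Ω) :=
  sup_le (iSup_le fun i => (hτ i).comap_le)
    (MeasurableSpace.generateFrom_le fun _ hA => hA.1)

theorem exists_adapted_scheme_solution [IsProbabilityMeasure P] (hab : a < b) (hn : 0 < n)
    (hK : 0 < K) (hL : 0 < L) (hτ : ∀ j, Measurable (τ j))
    (hu : ∀ j, pdf.IsUniform (τ j) (Icc 0 1) P volume) (hδ : δ ∈ Icc (0 : ℝ) 1)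
    (hf : IVPClass a b ρ K L ∞ η f) (hf' : NoisyInfo a b δ η f η' f')
    (h1 : step a b n * (K + 1) ≤ 1 / 2) (h2 : step a b n * L ≤ 1 / 2) :
    ∃ U : ℕ → Ω → Vec d, IsSchemeSolution P a b n τ η' f' U ∧
      (∀ j ≤ n, Measurable[filt P τ j] (U j)) ∧
      ∀ V : ℕ → Ω → Vec d, IsSchemeSolution P a b n τ η' f' V →
        ∀ᵐ ω ∂P, ∀ j ≤ n, V j ω = U j ω := by
  have hh := (step_pos hab hn).le
  have hq : step a b n * (L + δ) < 1 :=
    (mul_add_le_of_step_le hh hK hδ.2 h1 h2).trans_lt (sub_lt_self _ (by positivity))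
  obtain ⟨Φ, hΦm, hΦ⟩ := exists_measurable_implicit_step hh (by linarith [hδ.1]) hq
    (hf'.measurable hf) fun t ht x y => hf'.lipschitz hf ht x y
  -- The `τ j` lie in `[0, 1]` only almost surely; projecting makes the sample time lie in `[a, b]`
  -- for every `ω` without changing it almost surely.
  set θ : Fin n → Ω → Icc a b :=
    fun j ω => projIcc a b hab.le (node a b n j + τ j ω * step a b n) with hθ
  set U : ℕ → Ω → Vec d := fun j => Nat.rec (fun _ => η')
    (fun j u ω => if hj : j < n then Φ (θ ⟨j, hj⟩ ω, u ω) else u ω) j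
  have hU0 (ω : Ω) : U 0 ω = η' := rfl
  have hUs (j : Fin n) (ω : Ω) : U (j + 1) ω = Φ (θ j ω, U j ω) := by
    change (if hj : (j : ℕ) < n then Φ (θ ⟨j, hj⟩ ω, U j ω) else U j ω) = _
    rw [dif_pos j.2]
  have hθeq : ∀ᵐ ω ∂P, ∀ j, (θ j ω : ℝ) = node a b n j + τ j ω * step a b n := by
    filter_upwards [ae_mem_of_isUniform hτ hu] with ω hω j
    have := Icc_node_subset hab hn j (sample_mem_Icc_node hab hn j (hω j))
    simp only [hθ]
    rw [projIcc_of_mem hab.le this]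
  refine ⟨U, ?_, fun j hj => ?_, fun V hV => ?_⟩
  · filter_upwards [hθeq] with ω hω
    refine ⟨hU0 ω, fun j => ?_⟩
    rw [← hω j]
    exact (hΦ _ _ _).2 (hUs j ω)
  · induction j with
    | zero => exact measurable_const
    | succ j ih =>
      have e : U (j + 1) = fun ω => Φ (θ ⟨j, hj⟩ ω, U j ω) := funext (hUs ⟨j, hj⟩)
      rw [e]
      have m1 : Measurable[filt P τ (j + 1)] (U j) :=
        (ih (by omega)).mono (filt_mono (Nat.le_succ j)) le_rfl
      have m2 : Measurable[filt P τ (j + 1)] (θ ⟨j, hj⟩) :=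
        continuous_projIcc.measurable.comp
          (((measurable_filt_of_lt (P := P) (τ := τ) (i := ⟨j, hj⟩) (Nat.lt_succ_self j)).mul_const
            _).const_add _)
      exact hΦm.comp (m2.prodMk m1)
  · filter_upwards [hθeq, hV] with ω hω hVω j hj
    induction j with
    | zero => rw [hVω.1, hU0]
    | succ j ih =>
      have h3 := hVω.2 ⟨j, hj⟩
      rw [← hω] at h3
      have h4 := (hΦ _ _ _).1 h3
      simp only [ih (by omega)] at h4
      rw [h4, ← hUs ⟨j, hj⟩ ω]

end Scheme

/-! ### Pathwise error bound -/

section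

/-- Discrete Gronwall inequality, from `1 + c ≤ exp c`. -/
theorem le_exp_mul_of_forall_lt {n : ℕ} {v : ℕ → ℝ} {c r : ℝ} (hc : 0 ≤ c) (hr : 0 ≤ r)
    (hv0 : 0 ≤ v 0) (hv : ∀ k < n, v (k + 1) ≤ (1 + c) * v k + r) {k : ℕ} (hk : k ≤ n) :
    v k ≤ (v 0 + k * r) * Real.exp (k * c) := by
  induction k with
  | zero => simp
  | succ k ih =>
    have h1 := ih (by omega)
    have h2 : 1 + c ≤ Real.exp c := by linarith [Real.add_one_le_exp c]
    have h3 : 0 ≤ (v 0 + k * r) * Real.exp (k * c) := by positivity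
    have h4 : 1 ≤ Real.exp ((k + 1 : ℕ) * c) := Real.one_le_exp (by positivity)
    calc v (k + 1) ≤ (1 + c) * v k + r := hv k (by omega)
      _ ≤ (1 + c) * ((v 0 + k * r) * Real.exp (k * c)) + r * Real.exp ((k + 1 : ℕ) * c) :=
        add_le_add (mul_le_mul_of_nonneg_left h1 (by linarith)) (le_mul_of_one_le_right hr h4)
      _ ≤ Real.exp c * ((v 0 + k * r) * Real.exp (k * c)) + r * Real.exp ((k + 1 : ℕ) * c) := by
        gcongr
      _ = _ := by
        push_cast
        rw [show ((k : ℝ) + 1) * c = k * c + c by ring, Real.exp_add]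
        ring

/-- The constant in the pathwise error bound at the grid points. -/
def gridErrorConst (a b K L : ℝ) : ℝ :=
  1 + Real.exp ((b - a) * ((L + 1) / (K / (2 * (K + 1))))) *
    (1 + (b - a) / (K / (2 * (K + 1))) *
      (L * (K * (1 + solutionBound a b K)) + solutionBound a b K + L + 2))

/-- The error of the one-point quadrature rule with nodes `θ j` for the increments of `z` over the
grid intervals. -/
def quadError {d : ℕ} (a b : ℝ) (n : ℕ) (f : ℝ → Vec d → Vec d) (z : ℝ → Vec d) (θ : Fin n → ℝ)
    (j : Fin n) : Vec d :=
  step a b n • f (θ j) (z (θ j)) - (z (node a b n (j + 1)) - z (node a b n j))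

variable {d : ℕ} {a b ρ K L δ : ℝ} {η η' : Vec d} {f f' : ℝ → Vec d → Vec d} {n : ℕ}
  {z : ℝ → Vec d}

/-- Pass from `z s` to `z t`, then from `z t` to `x`, then add the noise. The linear growth of the
noise is measured through `‖x‖ ≤ ‖z t‖ + ‖z t - x‖`, which puts `δ` into the Lipschitz factor as
well. -/
theorem norm_sub_noisy_le (hK : 0 < K) (hL : 0 < L)
    (hf : IVPClass a b ρ K L ∞ η f) (hf' : NoisyInfo a b δ η f η' f') (hδ : 0 ≤ δ)
    (hz : IsODESolution a b η f z) {s t : ℝ} (hs : s ∈ Icc a b) (ht : t ∈ Icc a b) (x : Vec d) :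
    ‖f s (z s) - f' s x‖ ≤ L * (K * (1 + solutionBound a b K) * |s - t|) +
      δ * (1 + solutionBound a b K) + (L + δ) * ‖z t - x‖ := by
  obtain ⟨-, g, hg, hfg⟩ := hf'
  have h1 : ‖f s (z s) - f s (z t)‖ ≤ L * (K * (1 + solutionBound a b K) * |s - t|) :=
    (hf.lipschitz_univ hs _ _).trans
      (mul_le_mul_of_nonneg_left (hz.norm_sub_le hK hf.norm_init hf.growth ht hs) hL.le)
  have h2 := hf.lipschitz_univ hs (z t) x
  have h3 : ‖x‖ ≤ solutionBound a b K + ‖z t - x‖ := by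
    have h4 := hz.norm_le hK hf.norm_init hf.growth ht
    have h5 := norm_sub_le (z t) (z t - x)
    rw [sub_sub_cancel] at h5
    linarith
  have h4 : ‖g s x‖ ≤ δ * (1 + (solutionBound a b K + ‖z t - x‖)) :=
    (hg.growth s hs x).trans (mul_le_mul_of_nonneg_left (by linarith) hδ)
  have e : f s (z s) - f' s x = (f s (z s) - f s (z t)) + (f s (z t) - f s x) - g s x := by
    rw [hfg s hs]
    abel
  rw [e]
  refine (norm_sub_le_of_le (norm_add_le_of_le h1 h2) h4).trans (le_of_eq ?_)
  ring

theorem norm_sub_le_gridErrorConst (hab : a < b) (hn : 0 < n) (hK : 0 < K) (hL : 0 < L)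
    (hδ : δ ∈ Icc (0 : ℝ) 1) (hf : IVPClass a b ρ K L ∞ η f) (hf' : NoisyInfo a b δ η f η' f')
    (h1 : step a b n * (K + 1) ≤ 1 / 2) (h2 : step a b n * L ≤ 1 / 2)
    (hz : IsODESolution a b η f z) {θ : Fin n → ℝ}
    (hθ : ∀ j : Fin n, θ j ∈ Icc (node a b n j) (node a b n (j + 1))) {u : ℕ → Vec d}
    (hu0 : u 0 = η')
    (hu : ∀ j : Fin n, u (j + 1) = u j + step a b n • f' (θ j) (u (j + 1))) {m : ℝ}
    (hm : ∀ k ≤ n, ‖partialSum (quadError a b n f z θ) k‖ ≤ m) {k : ℕ} (hk : k ≤ n) :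
    ‖z (node a b n k) - u k‖ ≤ gridErrorConst a b K L * (step a b n + δ + m) := by
  have hm0 : 0 ≤ m := (norm_nonneg _).trans (hm 0 (Nat.zero_le n))
  have hh := step_pos hab hn
  have hq := mul_add_le_of_step_le hh.le hK hδ.2 h1 h2
  have hZ : 0 ≤ solutionBound a b K := solutionBound_nonneg hab hK
  have hba := sub_pos.2 hab
  have hnh : n * step a b n = b - a := mul_step hn
  obtain ⟨hδ0, hδ1⟩ := hδ
  unfold gridErrorConst
  have hκ : 0 < K / (2 * (K + 1)) := by positivity
  set Z := solutionBound a b K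
  set κ := K / (2 * (K + 1))
  set h := step a b n
  set e : ℕ → Vec d := fun k => z (node a b n k) - u k with he
  set S : ℕ → Vec d := partialSum (quadError a b n f z θ) with hS
  set B := L * (K * (1 + Z)) * h + δ * (1 + Z) + (L + 1) * m with hB
  have hB0 : 0 ≤ B := by positivity
  have hrec : ∀ k < n, ‖e (k + 1) + S (k + 1)‖ ≤
      (1 + h * ((L + 1) / κ)) * ‖e k + S k‖ + h / κ * B := by
    intro k hk
    have h3 := norm_sub_noisy_le hK hL hf hf' hδ0 hz (s := θ ⟨k, hk⟩) (t := node a b n (k + 1))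
      (Icc_node_subset hab hn ⟨k, hk⟩ (hθ ⟨k, hk⟩)) (node_mem_Icc hab hn hk) (u (k + 1))
    have habs : |θ ⟨k, hk⟩ - node a b n (k + 1)| ≤ h := by
      obtain ⟨h4, h5⟩ := hθ ⟨k, hk⟩
      have h6 := node_succ (a := a) (b := b) (n := n) k
      simp only at h4 h5
      rw [abs_le]
      constructor <;> linarith
    have hSs : S (k + 1) = S k + quadError a b n f z θ ⟨k, hk⟩ :=
      partialSum_succ (quadError a b n f z θ) ⟨k, hk⟩
    -- Adding `S` cancels the increment of `z`, so no pointwise quadrature error, only its partial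
    -- sums, enters the estimate.
    have heq : e (k + 1) + S (k + 1) = (e k + S k) +
        h • (f (θ ⟨k, hk⟩) (z (θ ⟨k, hk⟩)) - f' (θ ⟨k, hk⟩) (u (k + 1))) := by
      have h4 : u (k + 1) - h • f' (θ ⟨k, hk⟩) (u (k + 1)) = u k :=
        sub_eq_of_eq_add (hu ⟨k, hk⟩)
      rw [hSs, he]
      simp only [quadError, smul_sub]
      rw [← h4]
      abel
    have h4 : ‖e (k + 1)‖ ≤ ‖e (k + 1) + S (k + 1)‖ + m := by
      have h5 := norm_sub_le (e (k + 1) + S (k + 1)) (S (k + 1))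
      rw [add_sub_cancel_right] at h5
      linarith [hm (k + 1) hk]
    have h5 : ‖f (θ ⟨k, hk⟩) (z (θ ⟨k, hk⟩)) - f' (θ ⟨k, hk⟩) (u (k + 1))‖ ≤
        B + (L + δ) * ‖e (k + 1) + S (k + 1)‖ := by
      have h6 : L * (K * (1 + Z) * |θ ⟨k, hk⟩ - node a b n (k + 1)|) ≤
          L * (K * (1 + Z)) * h := by
        rw [mul_assoc L]
        gcongr
      have h7 : (L + δ) * ‖e (k + 1)‖ ≤ (L + δ) * ‖e (k + 1) + S (k + 1)‖ + (L + 1) * m := by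
        calc (L + δ) * ‖e (k + 1)‖ ≤ (L + δ) * (‖e (k + 1) + S (k + 1)‖ + m) := by gcongr
          _ ≤ _ := by
            rw [mul_add]
            gcongr
      calc _ ≤ _ := h3
        _ ≤ L * (K * (1 + Z)) * h + δ * (1 + Z) +
            ((L + δ) * ‖e (k + 1) + S (k + 1)‖ + (L + 1) * m) :=
          add_le_add (add_le_add h6 le_rfl) h7
        _ = _ := by
          rw [hB]
          ring
    have h6 : ‖e (k + 1) + S (k + 1)‖ ≤
        ‖e k + S k‖ + h * (B + (L + δ) * ‖e (k + 1) + S (k + 1)‖) := by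
      conv_lhs => rw [heq]
      refine norm_add_le_of_le le_rfl ?_
      rw [norm_smul, Real.norm_of_nonneg hh.le]
      exact mul_le_mul_of_nonneg_left h5 hh.le
    set w := ‖e (k + 1) + S (k + 1)‖
    set v := ‖e k + S k‖
    have hw : 0 ≤ w := norm_nonneg _
    have h7 : κ * w ≤ v + h * B := by
      have h8 : h * (L + δ) * w ≤ (1 - κ) * w := mul_le_mul_of_nonneg_right hq hw
      linarith
    have h8 : w ≤ (v + h * B) / κ := by
      rw [le_div_iff₀ hκ]
      linarith
    have h11 : 0 ≤ h * B := by positivity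
    -- The crude bound on `w` has growth factor `1 / κ`, which would explode over `n` steps.
    -- Inserting it only into the implicit term, which carries a factor `h`, gives a growth factor
    -- `1 + O(h)`.
    have h12 : h * (L + δ) * w ≤ h * (L + 1) * (v / κ) + (1 - κ) * (h * B / κ) := by
      have h13 : w ≤ v / κ + h * B / κ := by rwa [← add_div]
      calc h * (L + δ) * w ≤ h * (L + δ) * (v / κ + h * B / κ) := by gcongr
        _ = h * (L + δ) * (v / κ) + h * (L + δ) * (h * B / κ) := mul_add _ _ _
        _ ≤ _ := by gcongr
    have h14 : (1 - κ) * (h * B / κ) = h / κ * B - h * B := by field_simp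
    have h15 : h * (L + 1) * (v / κ) = h * ((L + 1) / κ) * v := by ring
    rw [h14, h15] at h12
    linarith
  have hgr := le_exp_mul_of_forall_lt (v := fun k => ‖e k + S k‖) (by positivity)
    (by positivity) (norm_nonneg _) hrec hk
  have h3 : ‖e 0 + S 0‖ ≤ δ := by
    have h4 : node a b n 0 = a := by simp [node]
    simp only [hS, partialSum_zero, add_zero, he, h4, hu0, hz.1]
    have := hf'.1
    rwa [Metric.mem_closedBall, dist_comm, dist_eq_norm] at this
  have hkh : (k : ℝ) * h ≤ b - a := by
    rw [← hnh]
    gcongr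
  have h4 : ‖e k + S k‖ ≤ (δ + (b - a) / κ * B) * Real.exp ((b - a) * ((L + 1) / κ)) := by
    refine hgr.trans ?_
    rw [← mul_assoc, ← mul_assoc]
    have h5 : (k : ℝ) * (h / κ) ≤ (b - a) / κ := by
      rw [← mul_div_assoc]
      gcongr
    gcongr
  have h5 : ‖e k‖ ≤ ‖e k + S k‖ + m := by
    have h5 := norm_sub_le (e k + S k) (S k)
    rw [add_sub_cancel_right] at h5
    linarith [hm k hk]
  have h6 : B ≤ (L * (K * (1 + Z)) + Z + L + 2) * (h + δ + m) := by
    have : 0 ≤ L * (K * (1 + Z)) := by positivity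
    rw [hB]
    nlinarith [mul_nonneg this hδ0, mul_nonneg this hm0, mul_nonneg hZ hh.le, mul_nonneg hZ hm0,
      mul_nonneg hL.le hh.le, mul_nonneg hL.le hδ0]
  have h7 : δ + (b - a) / κ * B ≤ (1 + (b - a) / κ * (L * (K * (1 + Z)) + Z + L + 2)) *
      (h + δ + m) := by
    have h8 : (b - a) / κ * B ≤ (b - a) / κ * ((L * (K * (1 + Z)) + Z + L + 2) * (h + δ + m)) :=
      mul_le_mul_of_nonneg_left h6 (by positivity)
    rw [add_mul, one_mul, mul_assoc]
    linarith
  have h8 := mul_le_mul_of_nonneg_right h7 (Real.exp_pos ((b - a) * ((L + 1) / κ))).le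
  change ‖e k‖ ≤ _
  have h9 : m ≤ h + δ + m := by linarith
  calc ‖e k‖ ≤ _ := h5
    _ ≤ _ := add_le_add (h4.trans h8) h9
    _ = _ := by ring

theorem exists_mem_Icc_node (hn : 0 < n) {t : ℝ} (ht : t ∈ Icc a b) :
    ∃ j : Fin n, t ∈ Icc (node a b n j) (node a b n (j + 1)) := by
  have key : ∀ k, t ≤ node a b n (k + 1) →
      ∃ j ≤ k, t ∈ Icc (node a b n j) (node a b n (j + 1)) := by
    intro k
    induction k with
    | zero => exact fun h => ⟨0, le_rfl, by simpa [node] using ht.1, h⟩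
    | succ k ih =>
      intro h
      rcases le_total t (node a b n (k + 1)) with h' | h'
      · obtain ⟨j, hj, hjt⟩ := ih h'
        exact ⟨j, hj.trans (Nat.le_succ k), hjt⟩
      · exact ⟨k + 1, le_rfl, h', h⟩
  have hb : node a b n (n - 1 + 1) = b := by
    rw [Nat.sub_add_cancel hn, node, mul_step hn]
    ring
  obtain ⟨j, hj, hjt⟩ := key (n - 1) (hb.symm ▸ ht.2)
  exact ⟨⟨j, by omega⟩, hjt⟩

/-- The interpolant is a convex combination of two neighbouring nodal values, and `z` moves by
`O(h)` between either node and `t`. -/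
theorem norm_sub_interp_le (hab : a < b) (hn : 0 < n) (hK : 0 < K)
    (hf : IVPClass a b ρ K L ∞ η f) (hz : IsODESolution a b η f z) {u : ℕ → Vec d} {E : ℝ}
    (hE : ∀ k ≤ n, ‖z (node a b n k) - u k‖ ≤ E) {t : ℝ} (ht : t ∈ Icc a b) :
    ‖z t - interp a b n u t‖ ≤ K * (1 + solutionBound a b K) * step a b n + E := by
  have hh := step_pos hab hn
  have hZ : 0 ≤ solutionBound a b K := solutionBound_nonneg hab hK
  obtain ⟨j, hj⟩ := exists_mem_Icc_node hn ht
  rw [interp_eq hab hn u j hj]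
  set M := K * (1 + solutionBound a b K)
  have hM : 0 ≤ M := by positivity
  set s := (t - node a b n j) / step a b n
  have hs : s ∈ Icc (0 : ℝ) 1 := by
    rw [node_succ] at hj
    refine ⟨div_nonneg (sub_nonneg.2 hj.1) hh.le, (div_le_one hh).2 (by linarith [hj.2])⟩
  have hj' := hj
  rw [node_succ] at hj'
  have hclose {r : ℝ} (hr : r ∈ Icc a b) (h : |t - r| ≤ step a b n) {x : Vec d}
      (hx : ‖z r - x‖ ≤ E) : ‖z t - x‖ ≤ M * step a b n + E := by
    rw [← sub_add_sub_cancel (z t) (z r) x]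
    exact norm_add_le_of_le ((hz.norm_sub_le hK hf.norm_init hf.growth hr ht).trans
      (mul_le_mul_of_nonneg_left h hM)) hx
  have h0 := hclose (node_mem_Icc hab hn j.2.le)
    (abs_le.2 ⟨by linarith [hj'.1], by linarith [hj'.2]⟩) (hE j j.2.le)
  have h1 := hclose (node_mem_Icc hab hn j.2)
    (abs_le.2 (by rw [node_succ]; exact ⟨by linarith [hj'.1], by linarith [hj'.2]⟩))
    (hE (j + 1) j.2)
  have e : z t - (s • (u (j + 1) - u j) + u j) =
      (1 - s) • (z t - u j) + s • (z t - u (j + 1)) := by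
    module
  rw [e]
  refine (norm_add_le _ _).trans ?_
  rw [norm_smul, norm_smul, Real.norm_of_nonneg hs.1, Real.norm_of_nonneg (sub_nonneg.2 hs.2)]
  calc _ ≤ (1 - s) * (M * step a b n + E) + s * (M * step a b n + E) :=
        add_le_add (mul_le_mul_of_nonneg_left h0 (sub_nonneg.2 hs.2))
          (mul_le_mul_of_nonneg_left h1 hs.1)
    _ = _ := by ring

end

/-! ### Measurability of the supremum error -/

section

theorem iSup_denseSeq_eq {X : Type*} [TopologicalSpace X] [TopologicalSpace.SeparableSpace X]
    [Nonempty X] {g : X → ℝ≥0∞} (hg : Continuous g) :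
    ⨆ k, g (TopologicalSpace.denseSeq X k) = ⨆ x, g x := by
  refine le_antisymm (iSup_le fun k => le_iSup g _) (iSup_le fun x => ?_)
  exact isClosed_property (TopologicalSpace.denseRange_denseSeq X)
    (isClosed_le hg continuous_const)
    (fun k => le_iSup (fun k => g (TopologicalSpace.denseSeq X k)) k) x

variable {d : ℕ} {a b ρ K L δ : ℝ} {η η' : Vec d} {f f' : ℝ → Vec d → Vec d} {n : ℕ}
  {z : ℝ → Vec d}

section SupError

variable {Ω : Type*} {U : ℕ → Ω → Vec d}

/-- Rescaling every grid interval to `[0, 1]` removes the floor function and leaves suprema of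
continuous functions, which a dense sequence computes. -/
theorem supError_eq_iSup (hab : a < b) (hn : 0 < n) (ω : Ω) :
    supError a b n z U ω = ⨆ j : Fin n, ⨆ s : Icc (0 : ℝ) 1,
      ‖z (node a b n j + s * step a b n) - ((s : ℝ) • (U (j + 1) ω - U j ω) + U j ω)‖ₑ := by
  have hh := step_pos hab hn
  refine le_antisymm (iSup₂_le fun t ht => ?_) (iSup_le fun j => iSup_le fun s => ?_)
  · obtain ⟨j, hj⟩ := exists_mem_Icc_node hn ht
    rw [interp_eq hab hn _ j hj]
    have hj' := hj
    rw [node_succ] at hj'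
    have hs : (t - node a b n j) / step a b n ∈ Icc (0 : ℝ) 1 :=
      ⟨div_nonneg (sub_nonneg.2 hj'.1) hh.le, (div_le_one hh).2 (by linarith [hj'.2])⟩
    refine le_iSup_of_le j (le_iSup_of_le ⟨_, hs⟩ (le_of_eq ?_))
    simp only
    rw [div_mul_cancel₀ _ hh.ne', add_sub_cancel]
  · have hj := sample_mem_Icc_node hab hn j s.2
    refine le_iSup₂_of_le _ (Icc_node_subset hab hn j hj) (le_of_eq ?_)
    rw [interp_eq hab hn _ j hj, add_sub_cancel_left, mul_div_cancel_right₀ _ hh.ne']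

theorem measurable_supError [MeasurableSpace Ω] (hab : a < b) (hn : 0 < n) (hz : ContinuousOn z (Icc a b))
    (hU : ∀ j ≤ n, Measurable (U j)) : Measurable (supError a b n z U) := by
  have e : supError a b n z U = fun ω => ⨆ j : Fin n, ⨆ k,
      (fun s : Icc (0 : ℝ) 1 => ‖z (node a b n j + s * step a b n) -
        ((s : ℝ) • (U (j + 1) ω - U j ω) + U j ω)‖ₑ) (TopologicalSpace.denseSeq _ k) := by
    funext ω
    rw [supError_eq_iSup hab hn]
    refine iSup_congr fun j => (iSup_denseSeq_eq ?_).symm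
    have : Continuous fun s : Icc (0 : ℝ) 1 => z (node a b n j + s * step a b n) :=
      hz.comp_continuous (by fun_prop)
        fun s => Icc_node_subset hab hn j (sample_mem_Icc_node hab hn j s.2)
    exact (this.sub (by fun_prop)).enorm
  rw [e]
  refine Measurable.iSup fun j => Measurable.iSup fun k => ?_
  have h1 := hU j j.2.le
  have h2 := hU (j + 1) j.2
  simp only
  fun_prop

theorem supError_congr (hab : a < b) (hn : 0 < n) {V : ℕ → Ω → Vec d} {ω : Ω}
    (h : ∀ j ≤ n, V j ω = U j ω) : supError a b n z V ω = supError a b n z U ω := by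
  rw [supError_eq_iSup hab hn, supError_eq_iSup hab hn]
  refine iSup_congr fun j => iSup_congr fun s => ?_
  rw [h j j.2.le, h (j + 1) j.2]

theorem supError_le_ofReal {ω : Ω} {E : ℝ}
    (h : ∀ t ∈ Icc a b, ‖z t - interp a b n (fun j => U j ω) t‖ ≤ E) :
    supError a b n z U ω ≤ ENNReal.ofReal E :=
  iSup₂_le fun t ht => by
    rw [← ofReal_norm]
    exact ENNReal.ofReal_le_ofReal (h t ht)

end SupError

/-! ### Size and mean of the quadrature errors -/

section QuadError

/-- Up to sign this is the increment of `s ↦ z s - s • f (θ j) (z (θ j))`, whose derivative is `O(h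
^ ρ)` by Hölder continuity in time and Lipschitz continuity in space; apply the mean value
inequality. -/
theorem norm_quadError_le (hab : a < b) (hn : 0 < n) (hK : 0 < K) (hL : 0 < L) (hρ0 : 0 < ρ)
    (hρ1 : ρ ≤ 1) (hf : IVPClass a b ρ K L ∞ η f) (hh1 : step a b n ≤ 1)
    (hz : IsODESolution a b η f z) {θ : Fin n → ℝ} {j : Fin n}
    (hθ : θ j ∈ Icc (node a b n j) (node a b n (j + 1))) :
    ‖quadError a b n f z θ j‖ ≤
      L * (1 + K * (1 + solutionBound a b K)) * step a b n ^ ρ * step a b n := by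
  have hh := step_pos hab hn
  have hZ : 0 ≤ solutionBound a b K := solutionBound_nonneg hab hK
  have hsub := Icc_node_subset hab hn j
  have hsucc := node_succ (a := a) (b := b) (n := n) j
  set M := K * (1 + solutionBound a b K) with hM
  set h := step a b n with hhd
  set w : ℝ → Vec d := fun s => z s - s • f (θ j) (z (θ j)) with hw
  have hder : ∀ s ∈ Icc (node a b n j) (node a b n (j + 1)),
      HasDerivWithinAt w (f s (z s) - f (θ j) (z (θ j)))
        (Icc (node a b n j) (node a b n (j + 1))) s := by
    intro s hs
    have h1 := ((hz.2 s (hsub hs)).mono hsub).sub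
      ((hasDerivWithinAt_id s (Icc (node a b n j) (node a b n (j + 1)))).smul_const
        (f (θ j) (z (θ j))))
    rw [one_smul] at h1
    exact h1
  have hbound : ∀ s ∈ Icc (node a b n j) (node a b n (j + 1)),
      ‖f s (z s) - f (θ j) (z (θ j))‖ ≤ L * (1 + M) * h ^ ρ := by
    intro s hs
    have habs : |s - θ j| ≤ h :=
      abs_le.2 ⟨by linarith [hs.1, hθ.2], by linarith [hs.2, hθ.1]⟩
    have h1 : ‖f s (z s) - f (θ j) (z s)‖ ≤ L * h ^ ρ :=
      (hf.holder_univ (hsub hs) (hsub hθ) _).trans (mul_le_mul_of_nonneg_left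
        (Real.rpow_le_rpow (abs_nonneg _) habs hρ0.le) hL.le)
    have hhρ : h ≤ h ^ ρ := by
      simpa using Real.rpow_le_rpow_of_exponent_ge hh hh1 hρ1
    have h2 : ‖f (θ j) (z s) - f (θ j) (z (θ j))‖ ≤ L * (M * h ^ ρ) := by
      refine (hf.lipschitz_univ (hsub hθ) _ _).trans (mul_le_mul_of_nonneg_left ?_ hL.le)
      refine (hz.norm_sub_le hK hf.norm_init hf.growth (hsub hθ) (hsub hs)).trans ?_
      exact mul_le_mul_of_nonneg_left (habs.trans hhρ) (by positivity)
    rw [← sub_add_sub_cancel (f s (z s)) (f (θ j) (z s))]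
    refine (norm_add_le_of_le h1 h2).trans (le_of_eq ?_)
    ring
  have hle : node a b n j ≤ node a b n (j + 1) := by linarith
  have key := (convex_Icc _ _).norm_image_sub_le_of_norm_hasDerivWithin_le hder hbound
    (left_mem_Icc.2 hle) (right_mem_Icc.2 hle)
  have e : quadError a b n f z θ j = -(w (node a b n (j + 1)) - w (node a b n j)) := by
    simp only [quadError, hw, hsucc, add_smul, ← hhd]
    abel
  rw [e, norm_neg]
  refine key.trans (le_of_eq ?_)
  rw [hsucc, add_sub_cancel_left, Real.norm_of_nonneg hh.le]

theorem integral_comp_isUniform {Ω : Type*} [MeasurableSpace Ω] {P : Measure Ω} {σ : Ω → ℝ}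
    (hσ : Measurable σ) (hu : pdf.IsUniform σ (Icc 0 1) P volume) {φ : ℝ → ℝ}
    (hφ : Continuous φ) (t : ℝ) {h : ℝ} (hh : h ≠ 0) :
    h * ∫ ω, φ (t + σ ω * h) ∂P = ∫ s in t..(t + h), φ s := by
  have h1 : ∫ ω, φ (t + σ ω * h) ∂P = ∫ x, φ (t + x * h) ∂(P.map σ) :=
    (integral_map hσ.aemeasurable
      (f := fun x => φ (t + x * h)) (by fun_prop : Continuous _).aestronglyMeasurable).symm
  rw [h1, hu, ProbabilityTheory.cond]
  simp only [Real.volume_Icc, sub_zero, ENNReal.ofReal_one, inv_one, one_smul]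
  rw [integral_Icc_eq_integral_Ioc, ← intervalIntegral.integral_of_le zero_le_one]
  simp_rw [mul_comm _ h]
  rw [intervalIntegral.integral_comp_add_mul φ hh t]
  simp [hh]

theorem IsODESolution.continuous_projIcc (hab : a < b) (hf : IVPClass a b ρ K L ∞ η f)
    (hz : IsODESolution a b η f z) :
    Continuous fun s => f (projIcc a b hab.le s) (z (projIcc a b hab.le s)) := by
  have h1 : Continuous fun s => z (projIcc a b hab.le s) :=
    hz.continuousOn.comp_continuous (continuous_subtype_val.comp _root_.continuous_projIcc)
      fun s => (projIcc a b hab.le s).2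
  exact hf.cont.comp_continuous (f := fun s => ((projIcc a b hab.le s : ℝ),
    z (projIcc a b hab.le s))) ((continuous_subtype_val.comp _root_.continuous_projIcc).prodMk h1)
    fun s => ⟨(projIcc a b hab.le s).2, mem_univ _⟩

/-- `h` times the expectation at a uniform sample is the integral of `z'` over the grid interval,
which is the increment of `z`. -/
theorem integral_quadError_eq_zero {Ω : Type*} [MeasurableSpace Ω] {P : Measure Ω}
    [IsProbabilityMeasure P] (hab : a < b) (hn : 0 < n) {τ : Fin n → Ω → ℝ}
    (hτ : ∀ j, Measurable (τ j)) (hu : ∀ j, pdf.IsUniform (τ j) (Icc 0 1) P volume)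
    (hf : IVPClass a b ρ K L ∞ η f) (hz : IsODESolution a b η f z) (j : Fin n) (i : Fin d) :
    ∫ ω, quadError a b n f z
      (fun j => projIcc a b hab.le (node a b n j + τ j ω * step a b n)) j i ∂P = 0 := by
  have hh := step_pos hab hn
  have hsub := Icc_node_subset hab hn j
  have hsucc := node_succ (a := a) (b := b) (n := n) j
  have hle : node a b n j ≤ node a b n (j + 1) := by linarith
  set F : ℝ → Vec d := fun s => f (projIcc a b hab.le s) (z (projIcc a b hab.le s)) with hF
  have hFc : Continuous F := hz.continuous_projIcc hab hf
  have hφ : Continuous fun s => F s i := by fun_prop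
  have hint : ∫ s in (node a b n j)..(node a b n (j + 1)), F s i =
      z (node a b n (j + 1)) i - z (node a b n j) i := by
    refine intervalIntegral.integral_eq_sub_of_hasDeriv_right_of_le (f := fun s => z s i) hle ?_
      (fun s hs => ?_) (hφ.intervalIntegrable _ _)
    · have := hz.continuousOn.mono hsub
      fun_prop
    · have hs' : s ∈ Ico a b :=
        ⟨(hsub (Ioo_subset_Icc_self hs)).1, hs.2.trans_le (hsub (right_mem_Icc.2 hle)).2⟩
      have h1 := (hz.hasDerivWithinAt_Ici hs').mono Ioi_subset_Ici_self
      have h2 : F s = f s (z s) := by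
        simp only [hF, projIcc_of_mem hab.le (Ico_subset_Icc_self hs')]
      rw [h2]
      exact (PiLp.proj (𝕜 := ℝ) 1 (fun _ : Fin d => ℝ) i).hasFDerivAt.comp_hasDerivWithinAt s h1
  have hbdd : Integrable (fun ω => F (node a b n j + τ j ω * step a b n) i) P := by
    obtain ⟨B, hB⟩ := (isCompact_Icc (a := a) (b := b)).exists_bound_of_continuousOn
      (hφ.continuousOn (s := Icc a b))
    refine Integrable.of_bound (C := B)
      (hφ.measurable.comp (((hτ j).mul_const _).const_add _)).aestronglyMeasurable
      (Filter.Eventually.of_forall fun ω => ?_)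
    have := hB _ (projIcc a b hab.le (node a b n j + τ j ω * step a b n)).2
    simpa only [hF, projIcc_val] using this
  have e (ω : Ω) : quadError a b n f z
      (fun j => projIcc a b hab.le (node a b n j + τ j ω * step a b n)) j i =
      step a b n * F (node a b n j + τ j ω * step a b n) i -
        (z (node a b n (j + 1)) i - z (node a b n j) i) := rfl
  simp_rw [e]
  rw [integral_sub (hbdd.const_mul _) (integrable_const _), integral_const_mul,
    integral_comp_isUniform (hτ j) (hu j) hφ _ hh.ne', ← hsucc, hint]
  simp

end QuadError

end

/-! ### The error bound in `L^p` -/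

section

variable {d : ℕ} {a b ρ K L δ : ℝ} {η η' : Vec d} {f f' : ℝ → Vec d → Vec d} {n : ℕ}
  {z : ℝ → Vec d}

theorem norm_partialSum_le (x : Fin n → Vec d) {k : ℕ} (hk : k ≤ n) :
    ‖partialSum x k‖ ≤ ∑ i, maxPartialSum fun j => x j i := by
  rw [Vec.norm_eq_sum_abs]
  refine Finset.sum_le_sum fun i _ => ?_
  have e : partialSum x k i = partialSum (fun j => x j i) k := by
    simp [partialSum]
  rw [e]
  exact abs_partialSum_le_maxPartialSum _ hk

/-- Minkowski's inequality for the dominating function; `Y` itself need not be measurable. -/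
theorem lintegral_rpow_le_of_ae_le {Ω : Type*} [MeasurableSpace Ω] {P : Measure Ω}
    [IsProbabilityMeasure P] {p : ℝ} (hp : 1 ≤ p) {Y : Ω → ℝ≥0∞} {A B : ℝ} (hA : 0 ≤ A)
    (hB : 0 ≤ B) {m : Fin d → Ω → ℝ} (hm : ∀ i, Measurable (m i)) (hm0 : ∀ i ω, 0 ≤ m i ω) {D : ℝ≥0∞}
    (hD : ∀ i, eLpNorm (m i) (ENNReal.ofReal p) P ≤ D)
    (hY : ∀ᵐ ω ∂P, Y ω ≤ ENNReal.ofReal (A + B * ∑ i, m i ω)) :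
    (∫⁻ ω, Y ω ^ p ∂P) ^ (1 / p) ≤ ENNReal.ofReal A + ENNReal.ofReal B * (d * D) := by
  have hp0 : 0 < p := by linarith
  have hp1 : 1 ≤ ENNReal.ofReal p := by simpa using hp
  have hpos : ENNReal.ofReal p ≠ 0 := by simpa using hp0
  set G : Ω → ℝ := (fun _ => A) + B • ∑ i, m i with hG
  have hGv (ω : Ω) : G ω = A + B * ∑ i, m i ω := by
    simp [hG]
  have hG0 (ω : Ω) : 0 ≤ G ω := by
    rw [hGv]
    exact add_nonneg hA (mul_nonneg hB (Finset.sum_nonneg fun i _ => hm0 i ω))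
  have h1 : (∫⁻ ω, Y ω ^ p ∂P) ^ (1 / p) ≤ eLpNorm G (ENNReal.ofReal p) P := by
    rw [eLpNorm_eq_lintegral_rpow_enorm_toReal hpos ENNReal.ofReal_ne_top,
      ENNReal.toReal_ofReal hp0.le]
    refine ENNReal.rpow_le_rpow (lintegral_mono_ae ?_) (by positivity)
    filter_upwards [hY] with ω hω
    rw [Real.enorm_of_nonneg (hG0 ω), hGv]
    exact ENNReal.rpow_le_rpow hω hp0.le
  have hsm : ∀ i ∈ Finset.univ, AEStronglyMeasurable (m i) P :=
    fun i _ => (hm i).aestronglyMeasurable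
  have hsum : eLpNorm (∑ i, m i) (ENNReal.ofReal p) P ≤ d * D :=
    (eLpNorm_sum_le hsm hp1).trans ((Finset.sum_le_card_nsmul _ _ D fun i _ => hD i).trans
      (by simp))
  refine h1.trans ((eLpNorm_add_le aestronglyMeasurable_const
    ((Finset.aestronglyMeasurable_sum _ hsm).const_smul B) hp1).trans (add_le_add ?_ ?_))
  · rw [eLpNorm_const _ hpos (NeZero.ne P), measure_univ, ENNReal.one_rpow, mul_one,
      Real.enorm_of_nonneg hA]
  · rw [eLpNorm_const_smul, Real.enorm_of_nonneg hB]
    exact mul_le_mul_right hsum _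

/-- The coefficient of the statistical error in the `L^p` bound. -/
def statErrorConst (a b K L p : ℝ) : ℝ :=
  L * (1 + K * (1 + solutionBound a b K)) * √(b - a) * (momentConst p).toReal

theorem eLpNorm_maxPartialSum_quadError_le {Ω : Type*} [MeasurableSpace Ω] {P : Measure Ω}
    [IsProbabilityMeasure P] (hab : a < b) (hn : 0 < n) (hK : 0 < K) (hL : 0 < L) (hρ0 : 0 < ρ)
    (hρ1 : ρ ≤ 1) {p : ℝ} (hp : 0 < p) {τ : Fin n → Ω → ℝ} (hτ : ∀ j, Measurable (τ j))
    (hu : ∀ j, pdf.IsUniform (τ j) (Icc 0 1) P volume) (hind : iIndepFun τ P)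
    (hf : IVPClass a b ρ K L ∞ η f) (hh1 : step a b n ≤ 1) (hz : IsODESolution a b η f z)
    (i : Fin d) :
    Measurable (fun ω => maxPartialSum fun j => quadError a b n f z
      (fun j => projIcc a b hab.le (node a b n j + τ j ω * step a b n)) j i) ∧
    eLpNorm (fun ω => maxPartialSum fun j => quadError a b n f z
      (fun j => projIcc a b hab.le (node a b n j + τ j ω * step a b n)) j i)
      (ENNReal.ofReal p) P ≤
      ENNReal.ofReal (statErrorConst a b K L p * step a b n ^ (ρ + 1 / 2)) := by
  have hh := step_pos hab hn
  have hZ : 0 ≤ solutionBound a b K := solutionBound_nonneg hab hK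
  set X : Fin n → Ω → ℝ := fun j ω => quadError a b n f z
      (fun j => projIcc a b hab.le (node a b n j + τ j ω * step a b n)) j i with hX
  obtain ⟨F, hF⟩ : ∃ F : ℝ → Vec d,
      F = fun s => f (projIcc a b hab.le s) (z (projIcc a b hab.le s)) := ⟨_, rfl⟩
  have hFc : Continuous F := hF ▸ hz.continuous_projIcc hab hf
  set φ : Fin n → ℝ → ℝ := fun j x => step a b n * F (node a b n j + x * step a b n) i -
        (z (node a b n (j + 1)) i - z (node a b n j) i) with hφ
  have hφm (j : Fin n) : Measurable (φ j) := by
    have h2 : Continuous (φ j) := by fun_prop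
    exact h2.measurable
  -- Each error is a fixed measurable function of its own `τ j`, so independence is inherited.
  have hXφ : X = fun j => φ j ∘ τ j := by
    subst hF
    rfl
  have hXm (j : Fin n) : Measurable (X j) := hXφ ▸ (hφm j).comp (hτ j)
  have hXind : iIndepFun X P := hXφ ▸ hind.comp φ hφm
  set c := L * (1 + K * (1 + solutionBound a b K)) * step a b n ^ ρ * step a b n with hc
  have hc0 : 0 < c := by positivity
  have hb (j : Fin n) : ∀ᵐ ω ∂P, |X j ω| ≤ c := by
    filter_upwards [ae_mem_of_isUniform hτ hu] with ω hω
    have hmem := sample_mem_Icc_node hab hn j (hω j)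
    have h1 := norm_quadError_le hab hn hK hL hρ0 hρ1 hf hh1 hz (j := j)
      (θ := fun j => projIcc a b hab.le (node a b n j + τ j ω * step a b n))
      (by rwa [projIcc_of_mem hab.le (Icc_node_subset hab hn j hmem)])
    exact (PiLp.norm_apply_le (p := 1) (β := fun _ : Fin d => ℝ) _ i).trans h1
  refine ⟨measurable_maxPartialSum hXm, ?_⟩
  refine (eLpNorm_maxPartialSum_le hXm hXind hc0 hn hb
    (fun j => integral_quadError_eq_zero hab hn hτ hu hf hz j i) hp).trans (le_of_eq ?_)
  rw [← ENNReal.ofReal_toReal (momentConst_ne_top hp), ← ENNReal.ofReal_mul (by positivity)]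
  congr 1
  -- Since `n h = b - a`, summing `n` centred errors costs only `√n`: this is the gain of half an
  -- order.
  have h1 : √n * step a b n = √(b - a) * step a b n ^ (1 / 2 : ℝ) := by
    rw [← Real.sqrt_eq_rpow, ← Real.sqrt_mul (sub_pos.2 hab).le, ← mul_step (a := a) (b := b) hn,
      mul_assoc, Real.sqrt_mul (by positivity), Real.sqrt_mul_self hh.le]
  rw [statErrorConst, hc, Real.rpow_add hh]
  linear_combination (L * (1 + K * (1 + solutionBound a b K)) * step a b n ^ ρ *
    (momentConst p).toReal) * h1

/-- The constant in the error bound for the randomized implicit Euler scheme. -/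
def errorConst (a b : ℝ) (d : ℕ) (K L p : ℝ) : ℝ :=
  K * (1 + solutionBound a b K) + gridErrorConst a b K L +
    gridErrorConst a b K L * (d * statErrorConst a b K L p)

theorem gridErrorConst_pos (hab : a < b) (hK : 0 < K) (hL : 0 < L) :
    0 < gridErrorConst a b K L := by
  have hZ : 0 ≤ solutionBound a b K := solutionBound_nonneg hab hK
  have := sub_pos.2 hab
  unfold gridErrorConst
  positivity

theorem statErrorConst_nonneg (hab : a < b) (hK : 0 < K) (hL : 0 < L) (p : ℝ) :
    0 ≤ statErrorConst a b K L p := by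
  have hZ : 0 ≤ solutionBound a b K := solutionBound_nonneg hab hK
  unfold statErrorConst
  positivity

theorem errorConst_pos (hab : a < b) (hK : 0 < K) (hL : 0 < L) (p : ℝ) :
    0 < errorConst a b d K L p := by
  have hZ : 0 ≤ solutionBound a b K := solutionBound_nonneg hab hK
  have h1 := gridErrorConst_pos hab hK hL
  have h2 := statErrorConst_nonneg hab hK hL p
  unfold errorConst
  positivity

theorem lintegral_supError_rpow_le {Ω : Type*} [MeasurableSpace Ω] {P : Measure Ω}
    [IsProbabilityMeasure P] (hab : a < b) (hn : 0 < n) (hK : 0 < K) (hL : 0 < L) (hρ0 : 0 < ρ)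
    (hρ1 : ρ ≤ 1) {p : ℝ} (hp : 1 ≤ p) {τ : Fin n → Ω → ℝ} (hτ : ∀ j, Measurable (τ j))
    (hu : ∀ j, pdf.IsUniform (τ j) (Icc 0 1) P volume) (hind : iIndepFun τ P)
    (hδ : δ ∈ Icc (0 : ℝ) 1) (hf : IVPClass a b ρ K L ∞ η f) (hf' : NoisyInfo a b δ η f η' f')
    (h1 : step a b n * (K + 1) ≤ 1 / 2) (h2 : step a b n * L ≤ 1 / 2)
    (hz : IsODESolution a b η f z) {U : ℕ → Ω → Vec d}
    (hU : IsSchemeSolution P a b n τ η' f' U) :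
    (∫⁻ ω, supError a b n z U ω ^ p ∂P) ^ (1 / p) ≤
      ENNReal.ofReal (errorConst a b d K L p * (step a b n ^ min (ρ + 1 / 2) 1 + δ)) := by
  have hh := step_pos hab hn
  have hZ : 0 ≤ solutionBound a b K := solutionBound_nonneg hab hK
  have hC := gridErrorConst_pos hab hK hL
  have hS := statErrorConst_nonneg hab hK hL p
  have hδ0 := hδ.1
  have hh1 : step a b n ≤ 1 := by
    have : 0 ≤ step a b n * K := by positivity
    linarith
  have hm := eLpNorm_maxPartialSum_quadError_le hab hn hK hL hρ0 hρ1 (by linarith : 0 < p) hτ hu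
    hind hf hh1 hz
  have hpath : ∀ᵐ ω ∂P, supError a b n z U ω ≤ ENNReal.ofReal
      ((K * (1 + solutionBound a b K) * step a b n + gridErrorConst a b K L * (step a b n + δ)) +
        gridErrorConst a b K L * ∑ i, maxPartialSum fun j => quadError a b n f z
          (fun j => projIcc a b hab.le (node a b n j + τ j ω * step a b n)) j i) := by
    filter_upwards [ae_mem_of_isUniform hτ hu, hU] with ω hω hUω
    have hmem (j : Fin n) := sample_mem_Icc_node hab hn j (hω j)
    have hθ (j : Fin n) : (projIcc a b hab.le (node a b n j + τ j ω * step a b n) : ℝ) =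
        node a b n j + τ j ω * step a b n := by
      rw [projIcc_of_mem hab.le (Icc_node_subset hab hn j (hmem j))]
    refine supError_le_ofReal fun t ht => ?_
    refine (norm_sub_interp_le hab hn hK hf hz (fun k hk =>
      norm_sub_le_gridErrorConst hab hn hK hL hδ hf hf' h1 h2 hz (u := fun j => U j ω)
      (θ := fun j => projIcc a b hab.le (node a b n j + τ j ω * step a b n))
      (fun j => by rw [hθ]; exact hmem j) hUω.1 (fun j => by rw [hθ]; exact hUω.2 j)
      (fun k hk => norm_partialSum_le _ hk) hk) ht).trans (le_of_eq ?_)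
    ring
  refine (lintegral_rpow_le_of_ae_le hp (by positivity) hC.le (fun i => (hm i).1)
    (fun i ω => maxPartialSum_nonneg _) (fun i => (hm i).2) hpath).trans ?_
  rw [← ENNReal.ofReal_natCast, ← ENNReal.ofReal_mul (by positivity),
    ← ENNReal.ofReal_mul hC.le, ← ENNReal.ofReal_add (by positivity) (by positivity)]
  refine ENNReal.ofReal_le_ofReal ?_
  -- As `h ≤ 1`, the power with the smaller exponent dominates both the `O(h)` bias and the
  -- statistical error.
  have e1 : step a b n ≤ step a b n ^ min (ρ + 1 / 2) 1 := by
    simpa using Real.rpow_le_rpow_of_exponent_ge hh hh1 (min_le_right (ρ + 1 / 2) 1)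
  have e2 : step a b n ^ (ρ + 1 / 2) ≤ step a b n ^ min (ρ + 1 / 2) 1 :=
    Real.rpow_le_rpow_of_exponent_ge hh hh1 (min_le_left _ _)
  set r := step a b n ^ min (ρ + 1 / 2) 1
  rw [errorConst, add_mul, add_mul]
  have e3 : step a b n ^ (ρ + 1 / 2) ≤ r + δ := by linarith
  refine add_le_add (add_le_add ?_ ?_) ?_
  · exact mul_le_mul_of_nonneg_left (by linarith) (by positivity)
  · exact mul_le_mul_of_nonneg_left (by linarith) hC.le
  · rw [mul_assoc (gridErrorConst a b K L), mul_assoc (d : ℝ)]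
    gcongr

end

end RandEuler

end

open RandEuler in
theorem theorem4p3 (a b : ℝ) (hab : a < b) (d : ℕ) (ρ : ℝ) (hρ0 : 0 < ρ) (hρ1 : ρ ≤ 1)
    (K L : ℝ) (hK : 0 < K) (hL : 0 < L) (p : ℝ) (hp : 2 ≤ p) :
    ∃ C : ℝ, 0 < C ∧
      ∀ (Ω : Type*) [MeasurableSpace Ω] (P : Measure Ω) [IsProbabilityMeasure P] [P.IsComplete]
        (n : ℕ) (τ : Fin n → Ω → ℝ) (δ : ℝ) (η : Vec d) (f : ℝ → Vec d → Vec d)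
        (η' : Vec d) (f' : ℝ → Vec d → Vec d),
        0 < n →
        (∀ j, Measurable (τ j)) →
        (∀ j, pdf.IsUniform (τ j) (Icc 0 1) P volume) →
        iIndepFun τ P →
        δ ∈ Icc (0 : ℝ) 1 →
        IVPClass a b ρ K L ∞ η f →
        NoisyInfo a b δ η f η' f' →
        step a b n * (K + 1) ≤ 1 / 2 →
        step a b n * L ≤ 1 / 2 →
        -- the initial-value problem has a unique solution on `[a, b]`
        (∃ z, IsODESolution a b η f z ∧
          ∀ z', IsODESolution a b η f z' → EqOn z' z (Icc a b)) ∧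
        -- the scheme has an adapted solution, and any two solutions agree almost surely
        (∃ U : ℕ → Ω → Vec d, IsSchemeSolution P a b n τ η' f' U ∧
          (∀ j ≤ n, Measurable[filt P τ j] (U j)) ∧
          ∀ V : ℕ → Ω → Vec d, IsSchemeSolution P a b n τ η' f' V →
            ∀ᵐ ω ∂P, ∀ j ≤ n, V j ω = U j ω) ∧
        -- error bound in `L^p(Ω)`
        ∀ (z : ℝ → Vec d) (U : ℕ → Ω → Vec d), IsODESolution a b η f z →
          IsSchemeSolution P a b n τ η' f' U →
          AEMeasurable (supError a b n z U) P ∧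
          (∫⁻ ω, supError a b n z U ω ^ p ∂P) ^ (1 / p) ≤
            ENNReal.ofReal (C * (step a b n ^ min (ρ + 1 / 2) 1 + δ)) := by
  refine ⟨errorConst a b d K L p, errorConst_pos hab hK hL p, ?_⟩
  intro Ω _ P _ _ n τ δ η f η' f' hn hτ hu hind hδ hf hf' h1 h2
  obtain ⟨U, hU, hUm, hUu⟩ := exists_adapted_scheme_solution hab hn hK hL hτ hu hδ hf hf' h1 h2
  obtain ⟨z, hz⟩ := hf.exists_isODESolution hab hK hL
  refine ⟨⟨z, hz, fun z' hz' => hz.eqOn hL (fun t ht => hf.lipschitz_univ ht) hz'⟩,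
    ⟨U, hU, hUm, hUu⟩, fun z V hz hV => ⟨?_, ?_⟩⟩
  -- An arbitrary solution `V` need not be measurable; the adapted solution `U` supplies the
  -- measurable version.
  · refine ⟨supError a b n z U, measurable_supError hab hn hz.continuousOn fun j hj =>
      (hUm j hj).mono (filt_le hτ j) le_rfl, ?_⟩
    filter_upwards [hUu V hV] with ω hω
    exact supError_congr hab hn hω
  · exact lintegral_supError_rpow_le hab hn hK hL hρ0 hρ1 (by linarith) hτ hu hind hδ hf hf' h1 h2
      hz hV
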